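/- For an integer $n\ge 1$ let $p(n,m)$ be the number of partitions of $n$ into exactly $m$ positive integer summands (order disregarded, repetitions allowed), and let $$m(n)=\frac{\sum_{m\ge 0} m\,p(n,m)}{\sum_{m\ge 0} p(n,m)}$$ be the expected number of summands of a partition of $n$ chosen uniformly at random. Then, as $n\to\infty$, $$m(n)=\frac{\sqrt{6n}}{\pi}\left(\gamma+\log\frac{\sqrt{6n}}{\pi}\right)\left[1+\mathcal{O}\left(n^{-1/2}\right)\right],$$ where $\gamma$ is the Euler–Mascheroni constant. -/

import Mathlib

open Filter Asymptotics

/-- `p(n, m)`: the number of partitions of `n` (into positive integers) with exactly `m` summands,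
counted with multiplicity. -/
def numPartitionsInto (n m : ℕ) : ℕ :=
  Fintype.card {p : n.Partition // Multiset.card p.parts = m}

/-- The `k`-th moment `t_k(n) = ∑ₘ mᵏ p(n, m)`; the sum stops at `m = n` because a partition
of `n` has at most `n` summands. -/
def partitionMoment (k n : ℕ) : ℕ :=
  ∑ m ∈ Finset.range (n + 1), m ^ k * numPartitionsInto n m

/-- The expected number of summands `m(n) = t_1(n) / t_0(n)` of a partition of `n`. -/
noncomputable def expectedSummands (n : ℕ) : ℝ :=
  (partitionMoment 1 n : ℝ) / (partitionMoment 0 n : ℝ)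

/-! Counting pairs (partition, part) gives `∑ m p(n,m) = ∑ d(k) p(n-k)`, and weighting each part by
its size gives `n p(n) = ∑ σ(k) p(n-k)`. Put `a(m) = p(m) e^{-αm}` with `α = π/√(6n)`, the saddle
point, and `S_{s,j} = ∑ k^j σ_s(k) e^{-αk}` (`sigmaSum`). No asymptotic formula for `p(n)` is
needed, only that `a` is nearly linear just below `n`: `a(n-k) = a(n) + kB + O(k² M)`, where `M = ∫
θ² |Φ(θ)| dθ` and `Φ(θ) = ∑ a(m) e^{imθ}` (`exists_abs_shiftedPartitions_sub_le`).

A circle-method estimate gives `M = O(α³ a(n))` (`exists_secondMoment_le_tiltedPartitions`): `Φ` is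
concentrated on `|θ| ≲ α^{3/2}`, and there the phase of `Φ(θ) e^{-inθ}` is small, so `a(n)` is at
least of order `α^{3/2} Φ(0)`.

The unknown slope `B` is found from the second identity. It reads `n a(n) = S_{1,0} a(n) + S_{1,1} B
+ O(S_{1,2} M)`, with `S_{1,0} = n + O(1/α)`, `S_{1,1} ≫ α⁻³` and `S_{1,2} = O(α⁻⁴)`, so `B = O(α²
a(n))`. The first identity then gives `m(n) = S_{0,0} + O(α S_{0,0}(α/2))`. Finally `S_{0,0} = (γ -
log α)/α + O(1)` (`abs_sigmaSum_zero_zero_sub_le`), so the relative error is `O(α) = O(n^{-1/2})`.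
-/

/-! ### Partition identities with divisor sums -/

open Finset in
/-- Removing `r` copies of `j` is a bijection from the partitions of `n` in which `j` occurs at
least `r` times to the partitions of `n - j * r`. -/
theorem card_partitions_le_count (n j r : ℕ) (hj : 0 < j) (h : j * r ≤ n) :
    #{p : n.Partition | r ≤ p.parts.count j} = Fintype.card (n - j * r).Partition := by
  rw [← Finset.card_univ]
  refine Finset.card_bij'
    (fun p hp => ⟨p.parts - Multiset.replicate r j, fun {i} hi =>
      p.parts_pos (Multiset.mem_of_le (Multiset.sub_le_self _ _) hi), ?_⟩)
    (fun q _ => ⟨q.parts + Multiset.replicate r j, fun {i} hi => ?_, ?_⟩) ?_ ?_ ?_ ?_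
  · have hle : Multiset.replicate r j ≤ p.parts :=
      Multiset.le_count_iff_replicate_le.1 (by simpa using hp)
    have := congrArg Multiset.sum (Multiset.sub_add_cancel hle)
    rw [Multiset.sum_add, p.parts_sum, Multiset.sum_replicate, smul_eq_mul, mul_comm] at this
    omega
  · rcases Multiset.mem_add.1 hi with hi | hi
    · exact q.parts_pos hi
    · rw [Multiset.eq_of_mem_replicate hi]; exact hj
  · rw [Multiset.sum_add, q.parts_sum, Multiset.sum_replicate, smul_eq_mul, mul_comm r j]
    omega
  · intro p hp; simp
  · intro q hq; simp
  · intro p hp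
    have hle : Multiset.replicate r j ≤ p.parts :=
      Multiset.le_count_iff_replicate_le.1 (by simpa using hp)
    ext1
    exact Multiset.sub_add_cancel hle
  · intro q hq
    ext1
    simp

open Finset in
theorem card_partitions_le_count_eq_zero (n j r : ℕ) (h : n < j * r) :
    #{p : n.Partition | r ≤ p.parts.count j} = 0 := by
  rw [Finset.card_eq_zero, Finset.filter_eq_empty_iff]
  intro p _ hp
  obtain ⟨u, hu⟩ := Multiset.le_iff_exists_add.1 (Multiset.le_count_iff_replicate_le.1 hp)
  have := congrArg Multiset.sum hu
  rw [Multiset.sum_add, p.parts_sum, Multiset.sum_replicate, smul_eq_mul, mul_comm] at this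
  omega

theorem Nat.Partition.le_of_mem {n i : ℕ} (p : n.Partition) (hi : i ∈ p.parts) : i ≤ n := by
  have := Multiset.le_sum_of_mem hi
  rwa [p.parts_sum] at this

theorem Nat.Partition.card_parts_le {n : ℕ} (p : n.Partition) : Multiset.card p.parts ≤ n := by
  have := Multiset.card_nsmul_le_sum (s := p.parts) (a := 1) fun i hi => p.parts_pos hi
  rw [p.parts_sum] at this
  simpa using this

open Finset in
/-- The sum of `f` over all parts of all partitions of `n`, as a convolution of the partition
function with the divisor sums of `f`. -/
theorem sum_partitions_sum_parts (f : ℕ → ℕ) (n : ℕ) :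
    ∑ p : n.Partition, (p.parts.map f).sum =
      ∑ x ∈ antidiagonal n, (∑ d ∈ x.1.divisors, f d) * Fintype.card x.2.Partition := by
  -- A multiplicity is the number of `r ≥ 1` not exceeding it, so the sum becomes one over pairs
  -- `(j, r)` to which the removal bijection applies.
  have h1 : ∀ p : n.Partition, (p.parts.map f).sum =
      ∑ j ∈ Icc 1 n, ∑ r ∈ Icc 1 n, if r ≤ p.parts.count j then f j else 0 := by
    intro p
    rw [Finset.sum_multiset_map_count]
    rw [Finset.sum_subset (s₂ := Icc 1 n)]
    · refine Finset.sum_congr rfl fun j _ => ?_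
      rw [← Finset.sum_filter, Finset.sum_const]
      congr 1
      have : (Icc 1 n).filter (fun r => r ≤ p.parts.count j) = Icc 1 (p.parts.count j) := by
        ext r
        have := (Multiset.count_le_card j p.parts).trans p.card_parts_le
        simp only [mem_filter, mem_Icc]
        omega
      rw [this]; simp
    · intro i hi
      have hi := Multiset.mem_toFinset.1 hi
      exact mem_Icc.2 ⟨p.parts_pos hi, p.le_of_mem hi⟩
    · intro i _ hi
      rw [Multiset.count_eq_zero_of_notMem (by simpa using hi)]; simp
  simp_rw [h1]
  rw [Finset.sum_comm]
  have h2 : ∀ j ∈ Icc 1 n, ∑ p : n.Partition, ∑ r ∈ Icc 1 n,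
      (if r ≤ p.parts.count j then f j else 0) =
      ∑ r ∈ Icc 1 n, if j * r ≤ n then f j * Fintype.card (n - j * r).Partition else 0 := by
    intro j hj
    rw [Finset.sum_comm]
    refine Finset.sum_congr rfl fun r _ => ?_
    rw [← Finset.sum_filter, Finset.sum_const, smul_eq_mul, mul_comm]
    split_ifs with h
    · rw [card_partitions_le_count n j r (mem_Icc.1 hj).1 h]
    · rw [card_partitions_le_count_eq_zero n j r (by omega)]; simp
  rw [Finset.sum_congr rfl h2, ← Finset.sum_product', ← Finset.sum_filter]
  simp_rw [Finset.sum_mul]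
  rw [Finset.sum_sigma']
  -- Group the pairs `(j, r)` by the product `k = j r`; then `j` runs over the divisors of `k`.
  refine Finset.sum_bij' (fun x _ => ⟨(x.1 * x.2, n - x.1 * x.2), x.1⟩)
    (fun y _ => (y.2, y.1.1 / y.2)) ?_ ?_ ?_ ?_ ?_
  · rintro ⟨j, r⟩ h
    simp only [mem_filter, mem_product, mem_Icc] at h
    simp only [mem_sigma, HasAntidiagonal.mem_antidiagonal, Nat.mem_divisors]
    refine ⟨by omega, Dvd.intro _ rfl, ?_⟩
    have := Nat.mul_pos h.1.1.1 h.1.2.1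
    omega
  · rintro ⟨⟨k, m⟩, d⟩ h
    simp only [mem_sigma, HasAntidiagonal.mem_antidiagonal, Nat.mem_divisors] at h
    obtain ⟨hkm, ⟨r, rfl⟩, h0⟩ := h
    have hd : 0 < d := Nat.pos_of_ne_zero fun h => h0 (by simp [h])
    have hr : 0 < r := Nat.pos_of_ne_zero fun h => h0 (by simp [h])
    simp only [mem_filter, mem_product, mem_Icc, Nat.mul_div_cancel_left r hd]
    have h1 : d ≤ d * r := Nat.le_mul_of_pos_right _ hr
    have h2 : r ≤ d * r := Nat.le_mul_of_pos_left _ hd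
    omega
  · rintro ⟨j, r⟩ h
    simp only [mem_filter, mem_product, mem_Icc] at h
    simp [Nat.mul_div_cancel_left r h.1.1.1]
  · rintro ⟨⟨k, m⟩, d⟩ h
    simp only [mem_sigma, HasAntidiagonal.mem_antidiagonal, Nat.mem_divisors] at h
    obtain ⟨hkm, hd, h0⟩ := h
    simp only [Nat.mul_div_cancel' hd]
    have : n - k = m := by omega
    rw [this]
  · rintro ⟨j, r⟩ h
    rfl

/-- The number of partitions of `n`. -/
def numPartitions (n : ℕ) : ℕ := Fintype.card n.Partition

theorem numPartitions_pos (n : ℕ) : 0 < numPartitions n := Fintype.card_pos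

theorem sum_mul_numPartitionsInto (g : ℕ → ℕ) (n : ℕ) :
    ∑ m ∈ Finset.range (n + 1), g m * numPartitionsInto n m =
      ∑ p : n.Partition, g (Multiset.card p.parts) := by
  rw [← Finset.sum_fiberwise_of_maps_to (s := Finset.univ) (t := Finset.range (n + 1))
    (g := fun p : n.Partition => Multiset.card p.parts)
    (fun p _ => Finset.mem_range.2 (Nat.lt_succ_of_le p.card_parts_le))]
  refine Finset.sum_congr rfl fun m _ => ?_
  rw [Finset.sum_congr rfl (g := fun _ => g m) fun p hp => by rw [(Finset.mem_filter.1 hp).2],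
    Finset.sum_const, smul_eq_mul, mul_comm, numPartitionsInto, Fintype.card_subtype]

theorem partitionMoment_zero (n : ℕ) : partitionMoment 0 n = numPartitions n := by
  have := sum_mul_numPartitionsInto (fun _ => 1) n
  simpa [partitionMoment, numPartitions] using this

open ArithmeticFunction in
theorem partitionMoment_one (n : ℕ) : partitionMoment 1 n =
    ∑ x ∈ Finset.HasAntidiagonal.antidiagonal n, sigma 0 x.1 * numPartitions x.2 := by
  have h := sum_mul_numPartitionsInto (fun m => m) n
  have h' := sum_partitions_sum_parts (fun _ => 1) n
  simp only [partitionMoment, pow_one, h, sigma_zero_apply, numPartitions]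
  simpa using h'

open ArithmeticFunction in
theorem mul_numPartitions (n : ℕ) : n * numPartitions n =
    ∑ x ∈ Finset.HasAntidiagonal.antidiagonal n, sigma 1 x.1 * numPartitions x.2 := by
  have h' := sum_partitions_sum_parts (fun d => d) n
  simp only [sigma_one_apply, numPartitions]
  rw [← h']
  simp [Nat.Partition.parts_sum, mul_comm]

/-! ### Exponential sums weighted by σ -/

section

open ArithmeticFunction Topology

/-- The sum `∑ₖ kʲ σₛ(k) e^{-αk}`. -/
noncomputable def sigmaSum (s j : ℕ) (α : ℝ) : ℝ :=
  ∑' k : ℕ, (k : ℝ) ^ j * sigma s k * Real.exp (-(α * k))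

theorem exp_neg_mul_eq_pow (α : ℝ) (k : ℕ) : Real.exp (-(α * k)) = Real.exp (-α) ^ k := by
  rw [← Real.exp_nat_mul]; ring_nf

theorem norm_exp_neg_lt_one {α : ℝ} (hα : 0 < α) : ‖Real.exp (-α)‖ < 1 := by
  rw [Real.norm_of_nonneg (Real.exp_pos _).le, Real.exp_lt_one_iff]; linarith

theorem summable_pow_mul_exp_neg (j : ℕ) {α : ℝ} (hα : 0 < α) :
    Summable fun k : ℕ => (k : ℝ) ^ j * Real.exp (-(α * k)) := by
  simp_rw [exp_neg_mul_eq_pow]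
  exact summable_pow_mul_geometric_of_norm_lt_one j (norm_exp_neg_lt_one hα)

theorem summable_sigmaSum (s j : ℕ) {α : ℝ} (hα : 0 < α) :
    Summable fun k : ℕ => (k : ℝ) ^ j * sigma s k * Real.exp (-(α * k)) := by
  refine (summable_pow_mul_exp_neg (j + (s + 1)) hα).of_nonneg_of_le
    (fun k => by positivity) fun k => ?_
  have h : (sigma s k : ℝ) ≤ (k : ℝ) ^ (s + 1) := by exact_mod_cast sigma_le_pow_succ s k
  rw [pow_add]
  gcongr

theorem sigmaSum_nonneg (s j : ℕ) (α : ℝ) : 0 ≤ sigmaSum s j α :=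
  tsum_nonneg fun k => by positivity

theorem sigmaSum_zero_eq_tsum_pnat (s : ℕ) (α : ℝ) :
    sigmaSum s 0 α = ∑' e : ℕ+, sigma s e * Real.exp (-α) ^ (e : ℕ) := by
  rw [tsum_pnat_eq_tsum_of_eq_zero (f := fun e : ℕ => (sigma s e : ℝ) * Real.exp (-α) ^ e)
    (by simp), sigmaSum]
  simp [exp_neg_mul_eq_pow]

/-- Half of the exponential absorbs the power, by `x^j / j! ≤ e^x` at `x = αk/2`. -/
theorem sigmaSum_le (s j : ℕ) {α : ℝ} (hα : 0 < α) :
    sigmaSum s j α ≤ j.factorial * (2 / α) ^ j * sigmaSum s 0 (α / 2) := by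
  rw [sigmaSum, sigmaSum, ← tsum_mul_left]
  refine (summable_sigmaSum s j hα).tsum_le_tsum (fun k => ?_)
    ((summable_sigmaSum s 0 (half_pos hα)).mul_left _)
  have h := Real.pow_div_factorial_le_exp (x := α / 2 * k) (by positivity) j
  rw [div_le_iff₀ (by positivity), mul_pow] at h
  have h2 : (k : ℝ) ^ j ≤ Real.exp (α / 2 * k) * (j.factorial * (2 / α) ^ j) := by
    have : (2 / α) ^ j * ((α / 2) ^ j * (k : ℝ) ^ j) = (k : ℝ) ^ j := by
      rw [← mul_assoc, ← mul_pow, div_mul_div_cancel₀ hα.ne', div_self two_ne_zero, one_pow,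
        one_mul]
    rw [← this]
    calc _ ≤ (2 / α) ^ j * (Real.exp (α / 2 * k) * j.factorial) := by gcongr
      _ = _ := by ring
  have h3 : Real.exp (-(α * k)) = Real.exp (-(α / 2 * k)) * Real.exp (-(α / 2 * k)) := by
    rw [← Real.exp_add]; ring_nf
  have h4 : Real.exp (α / 2 * k) * Real.exp (-(α / 2 * k)) = 1 := by
    rw [← Real.exp_add]; simp
  calc (k : ℝ) ^ j * sigma s k * Real.exp (-(α * k))
      ≤ (Real.exp (α / 2 * k) * (j.factorial * (2 / α) ^ j)) * sigma s k *
        Real.exp (-(α * k)) := by gcongr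
    _ = (Real.exp (α / 2 * k) * Real.exp (-(α / 2 * k))) * (j.factorial * (2 / α) ^ j *
        ((k : ℝ) ^ 0 * sigma s k * Real.exp (-(α / 2 * k)))) := by rw [h3]; ring
    _ = _ := by rw [h4, one_mul]

/-- The elementary bounds `1/x² - 1/4 ≤ e^{-x}/(1-e^{-x})² ≤ 1/x²`. -/
theorem exp_neg_div_sq_le {x : ℝ} (hx : 0 < x) :
    Real.exp (-x) / (1 - Real.exp (-x)) ^ 2 ≤ 1 / x ^ 2 ∧
      1 / x ^ 2 - 1 / 4 ≤ Real.exp (-x) / (1 - Real.exp (-x)) ^ 2 := by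
  have key : Real.exp (-x) / (1 - Real.exp (-x)) ^ 2 = 1 / (2 * Real.sinh (x / 2)) ^ 2 := by
    have h1 : Real.exp (-x) = Real.exp (-(x / 2)) ^ 2 := by
      rw [← Real.exp_nat_mul]; congr 1; push_cast; ring
    have h2 : 1 - Real.exp (-x) = Real.exp (-(x / 2)) * (2 * Real.sinh (x / 2)) := by
      rw [Real.sinh_eq, h1]
      have : Real.exp (-(x / 2)) * Real.exp (x / 2) = 1 := by rw [← Real.exp_add]; simp
      linear_combination -this
    rw [h2, mul_pow, h1]
    have := Real.exp_pos (-(x / 2))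
    have := Real.sinh_pos_iff.2 (half_pos hx)
    field_simp
  have hs : x / 2 ≤ Real.sinh (x / 2) := Real.self_le_sinh_iff.2 (half_pos hx).le
  -- Mean value theorem for `sinh`, together with `cosh y ≤ e^{y²/2}` at `y = x/2`.
  have hs' : Real.sinh (x / 2) ≤ x / 2 * Real.exp (x ^ 2 / 8) := by
    obtain ⟨ξ, hξ, h⟩ := exists_hasDerivAt_eq_slope Real.sinh Real.cosh (half_pos hx)
      Real.continuous_sinh.continuousOn fun y _ => Real.hasDerivAt_sinh y
    have h1 : Real.cosh ξ ≤ Real.cosh (x / 2) := by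
      rw [Real.cosh_le_cosh, abs_of_pos hξ.1, abs_of_pos (half_pos hx)]; exact hξ.2.le
    have h2 := Real.cosh_le_exp_half_sq (x / 2)
    rw [Real.sinh_zero, sub_zero, sub_zero, eq_div_iff (half_pos hx).ne'] at h
    rw [← h, mul_comm]
    gcongr
    refine h1.trans (h2.trans (le_of_eq ?_))
    ring_nf
  rw [key]
  constructor
  · gcongr; linarith
  · have h1 : (2 * Real.sinh (x / 2)) ^ 2 ≤ x ^ 2 * Real.exp (x ^ 2 / 4) := by
      calc (2 * Real.sinh (x / 2)) ^ 2 ≤ (2 * (x / 2 * Real.exp (x ^ 2 / 8))) ^ 2 := by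
            gcongr
        _ = x ^ 2 * Real.exp (x ^ 2 / 8) ^ 2 := by ring
        _ = _ := by rw [← Real.exp_nat_mul]; ring_nf
    have h2 : 1 / (x ^ 2 * Real.exp (x ^ 2 / 4)) ≤ 1 / (2 * Real.sinh (x / 2)) ^ 2 := by
      have := Real.sinh_pos_iff.2 (half_pos hx)
      gcongr
    refine le_trans ?_ h2
    have h3 : 1 - x ^ 2 / 4 ≤ (Real.exp (x ^ 2 / 4))⁻¹ := by
      rw [← Real.exp_neg]
      have := Real.add_one_le_exp (-(x ^ 2 / 4))
      linarith
    rw [one_div (x ^ 2 * _), mul_inv]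
    have : (x ^ 2)⁻¹ * (1 - x ^ 2 / 4) ≤ (x ^ 2)⁻¹ * (Real.exp (x ^ 2 / 4))⁻¹ := by gcongr
    refine le_trans (le_of_eq ?_) this
    field_simp

/-- Lambert rearrangement: write `k = d c` and sum `c e^{-αdc}` over `c` in closed form. -/
theorem sigmaSum_one_zero_eq {α : ℝ} (hα : 0 < α) : sigmaSum 1 0 α =
    ∑' r : ℕ, Real.exp (-(α * (r + 1))) / (1 - Real.exp (-(α * (r + 1)))) ^ 2 := by
  rw [sigmaSum_zero_eq_tsum_pnat, ← tsum_prod_pow_eq_tsum_sigma 1 (norm_exp_neg_lt_one hα),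
    tsum_pnat_eq_tsum_succ (f := fun d : ℕ => ∑' c : ℕ+, (c : ℝ) ^ 1 * Real.exp (-α) ^ (d * c))]
  refine tsum_congr fun r => ?_
  have h := tsum_coe_mul_geometric_of_norm_lt_one (𝕜 := ℝ) (r := Real.exp (-(α * (r + 1))))
    (norm_exp_neg_lt_one (by positivity))
  rw [← h, tsum_pnat_eq_tsum_of_eq_zero (f := fun c : ℕ => (c : ℝ) ^ 1 *
    Real.exp (-α) ^ ((r + 1) * c)) (by simp)]
  refine tsum_congr fun c => ?_
  rw [pow_one, pow_mul, ← Real.exp_nat_mul]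
  push_cast
  ring_nf

theorem abs_sigmaSum_one_zero_sub_le {α : ℝ} (hα : 0 < α) :
    sigmaSum 1 0 α ≤ Real.pi ^ 2 / (6 * α ^ 2) ∧
      Real.pi ^ 2 / (6 * α ^ 2) - 3 / α ≤ sigmaSum 1 0 α := by
  have hz : HasSum (fun r : ℕ => 1 / (α * ((r : ℝ) + 1)) ^ 2) (Real.pi ^ 2 / (6 * α ^ 2)) := by
    have h := (hasSum_nat_add_iff' 1).2 hasSum_zeta_two
    have h := h.mul_left (1 / α ^ 2)
    have e : 1 / α ^ 2 * (Real.pi ^ 2 / 6 - ∑ i ∈ Finset.range 1, 1 / (i : ℝ) ^ 2) =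
        Real.pi ^ 2 / (6 * α ^ 2) := by
      simp; field_simp
    rw [e] at h
    refine h.congr_fun fun r => ?_
    push_cast; field_simp
  have hpos : ∀ r : ℕ, 0 < α * ((r : ℝ) + 1) := fun r => by positivity
  have hs : Summable fun r : ℕ =>
      Real.exp (-(α * ((r : ℝ) + 1))) / (1 - Real.exp (-(α * (r + 1)))) ^ 2 :=
    hz.summable.of_nonneg_of_le (fun r => by positivity) fun r => (exp_neg_div_sq_le (hpos r)).1
  rw [sigmaSum_one_zero_eq hα, ← hz.tsum_eq]
  refine ⟨hs.tsum_le_tsum (fun r => (exp_neg_div_sq_le (hpos r)).1) hz.summable, ?_⟩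
  rw [sub_le_comm, ← hz.summable.tsum_sub hs]
  -- The deficit is at most `min(1/4, 1/x²) ≤ 3/(1+x)²`. Replacing one factor `1+x` by the smaller
  -- `1+x-α` makes the bound telescope, to a total of at most `3/α`.
  have hterm : ∀ r : ℕ, 1 / (α * ((r : ℝ) + 1)) ^ 2 -
      Real.exp (-(α * ((r : ℝ) + 1))) / (1 - Real.exp (-(α * (r + 1)))) ^ 2 ≤
      3 / α * (1 / (1 + α * r) - 1 / (1 + α * ((r + 1 : ℕ) : ℝ))) := by
    intro r
    set x := α * ((r : ℝ) + 1) with hx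
    have hx0 : 0 < x := hpos r
    have h1 : 1 / x ^ 2 - Real.exp (-x) / (1 - Real.exp (-x)) ^ 2 ≤ 3 / (1 + x) ^ 2 := by
      rcases le_total x 2 with h | h
      · have := (exp_neg_div_sq_le hx0).2
        have h3 : 1 / 4 ≤ 3 / (1 + x) ^ 2 := by
          rw [div_le_div_iff₀ (by norm_num) (by positivity)]; nlinarith
        linarith
      · have : 0 ≤ Real.exp (-x) / (1 - Real.exp (-x)) ^ 2 := by positivity
        have h3 : 1 / x ^ 2 ≤ 3 / (1 + x) ^ 2 := by
          rw [div_le_div_iff₀ (by positivity) (by positivity)]; nlinarith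
        linarith
    refine h1.trans ?_
    have h2 : 3 / α * (1 / (1 + α * r) - 1 / (1 + α * ((r + 1 : ℕ) : ℝ))) =
        3 / ((1 + α * r) * (1 + x)) := by
      rw [hx]; push_cast; field_simp; ring
    rw [h2, sq]
    gcongr
    rw [hx]; linarith
  refine Real.tsum_le_of_sum_range_le (fun r => ?_) fun N => ?_
  · have := (exp_neg_div_sq_le (hpos r)).1; linarith
  · refine (Finset.sum_le_sum fun r _ => hterm r).trans ?_
    rw [← Finset.mul_sum, Finset.sum_range_sub' (fun r : ℕ => 1 / (1 + α * (r : ℝ)))]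
    have : 0 ≤ 1 / (1 + α * (N : ℝ)) := by positivity
    have h3 : 0 < 3 / α := by positivity
    simp only [Nat.cast_zero, mul_zero, add_zero]
    nlinarith

theorem sigmaSum_one_le (j : ℕ) {α : ℝ} (hα : 0 < α) :
    sigmaSum 1 j α ≤ j.factorial * (2 / α) ^ j * (8 / α ^ 2) := by
  refine (sigmaSum_le 1 j hα).trans ?_
  gcongr
  refine (abs_sigmaSum_one_zero_sub_le (half_pos hα)).1.trans ?_
  rw [div_le_div_iff₀ (by positivity) (by positivity)]
  have := Real.pi_lt_d2
  have := Real.pi_pos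
  nlinarith [sq_nonneg α, mul_pos hα hα, mul_pos (mul_pos hα hα) Real.pi_pos]

/-- A finite difference replaces the derivative: `e^{-αk} - e^{-2αk} ≤ αk e^{-αk}` bounds `S_{1,1}`
below by the known sizes of `S_{1,0}` at `α` and `2α`. -/
theorem le_sigmaSum_one_one {α : ℝ} (hα : 0 < α) (h : α ≤ 1 / 6) :
    1 / (2 * α ^ 3) ≤ sigmaSum 1 1 α := by
  have h1 : sigmaSum 1 0 α - sigmaSum 1 0 (2 * α) ≤ α * sigmaSum 1 1 α := by
    have hs1 := summable_sigmaSum 1 0 hα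
    have hs2 := summable_sigmaSum 1 0 (mul_pos two_pos hα)
    simp only [sigmaSum]
    rw [← hs1.tsum_sub hs2, ← tsum_mul_left]
    refine (hs1.sub hs2).tsum_le_tsum (fun k => ?_) ((summable_sigmaSum 1 1 hα).mul_left _)
    have e1 : Real.exp (-(2 * α * k)) = Real.exp (-(α * k)) * Real.exp (-(α * k)) := by
      rw [← Real.exp_add]; ring_nf
    have e2 := Real.add_one_le_exp (-(α * k))
    rw [e1]
    have : 0 ≤ (sigma 1 k : ℝ) * Real.exp (-(α * k)) := by positivity
    have := mul_le_mul_of_nonneg_left (show 1 - Real.exp (-(α * k)) ≤ α * k by linarith) this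
    simp only [pow_zero, one_mul, pow_one]
    linarith
  have h2 := (abs_sigmaSum_one_zero_sub_le hα).2
  have h3 := (abs_sigmaSum_one_zero_sub_le (mul_pos two_pos hα)).1
  have h4 : Real.pi ^ 2 / (6 * α ^ 2) - 3 / α - Real.pi ^ 2 / (6 * (2 * α) ^ 2) ≤
      α * sigmaSum 1 1 α := by linarith
  have h5 : 1 / (2 * α ^ 2) ≤
      Real.pi ^ 2 / (6 * α ^ 2) - 3 / α - Real.pi ^ 2 / (6 * (2 * α) ^ 2) := by
    have : Real.pi ^ 2 / (6 * α ^ 2) - 3 / α - Real.pi ^ 2 / (6 * (2 * α) ^ 2) =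
      (Real.pi ^ 2 / 4 - 6 * α) / (2 * α ^ 2) := by field_simp; ring
    rw [this]
    gcongr
    nlinarith [Real.pi_gt_three]
  have h6 : 1 / (2 * α ^ 3) = (1 / (2 * α ^ 2)) / α := by field_simp
  rw [h6, div_le_iff₀ hα]
  linarith

/-! ### The Lambert series of the divisor function -/

theorem exp_sub_one_pos {x : ℝ} (hx : 0 < x) : 0 < Real.exp x - 1 :=
  sub_pos.2 (Real.one_lt_exp_iff.2 hx)

theorem one_sub_exp_neg_pos {x : ℝ} (hx : 0 < x) : 0 < 1 - Real.exp (-x) :=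
  sub_pos.2 (Real.exp_lt_one_iff.2 (neg_lt_zero.2 hx))

theorem exp_neg_div_one_sub_exp_neg (x : ℝ) :
    Real.exp (-x) / (1 - Real.exp (-x)) = 1 / (Real.exp x - 1) := by
  rw [Real.exp_neg]
  have := Real.exp_pos x
  by_cases h : Real.exp x = 1
  · simp [h]
  · have : Real.exp x - 1 ≠ 0 := sub_ne_zero.2 h
    field_simp

theorem hasDerivAt_log_one_sub_exp_neg_sub_log {x : ℝ} (hx : 0 < x) :
    HasDerivAt (fun x => Real.log (1 - Real.exp (-x)) - Real.log x)
      (1 / (Real.exp x - 1) - 1 / x) x := by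
  have h1 : HasDerivAt (fun x : ℝ => 1 - Real.exp (-x)) (Real.exp (-x)) x := by
    have := ((hasDerivAt_neg x).exp).const_sub 1
    simpa using this
  have h2 := (h1.log (one_sub_exp_neg_pos hx).ne').sub (Real.hasDerivAt_log hx.ne')
  rw [exp_neg_div_one_sub_exp_neg, ← one_div] at h2
  exact h2

theorem monotoneOn_inv_exp_sub_one_sub_inv :
    MonotoneOn (fun x : ℝ => 1 / (Real.exp x - 1) - 1 / x) (Set.Ioi 0) := by
  have hd : ∀ x ∈ Set.Ioi (0 : ℝ), HasDerivAt (fun x : ℝ => 1 / (Real.exp x - 1) - 1 / x)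
      (-Real.exp x / (Real.exp x - 1) ^ 2 + 1 / x ^ 2) x := by
    intro x hx
    have h1 := ((Real.hasDerivAt_exp x).sub_const 1).fun_inv (exp_sub_one_pos hx).ne'
    have h2 := h1.fun_sub (hasDerivAt_inv (ne_of_gt hx))
    simp only [one_div]
    exact h2.congr_deriv (by rw [sub_neg_eq_add])
  refine monotoneOn_of_deriv_nonneg (convex_Ioi 0)
    (fun x hx => (hd x hx).continuousAt.continuousWithinAt)
    (fun x hx => (hd x (interior_subset hx)).differentiableAt.differentiableWithinAt) ?_
  intro x hx
  have hx := interior_subset hx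
  rw [(hd x hx).deriv]
  have h := (exp_neg_div_sq_le hx).1
  have e : Real.exp (-x) / (1 - Real.exp (-x)) ^ 2 = Real.exp x / (Real.exp x - 1) ^ 2 := by
    rw [Real.exp_neg]
    have := Real.exp_pos x
    have := exp_sub_one_pos hx
    field_simp
  rw [neg_div, ← e]
  linarith

/-- The function `log(1 - e^{-x}) - log x` is convex, so its slopes lie between the endpoint
derivatives. This serves as an explicit comparison of sum and integral. -/
theorem slope_log_one_sub_exp_neg_bounds {x y : ℝ} (hx : 0 < x) (hxy : x < y) :
    (y - x) * (1 / (Real.exp x - 1) - 1 / x) ≤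
      (Real.log (1 - Real.exp (-y)) - Real.log y) - (Real.log (1 - Real.exp (-x)) - Real.log x) ∧
    (Real.log (1 - Real.exp (-y)) - Real.log y) - (Real.log (1 - Real.exp (-x)) - Real.log x) ≤
      (y - x) * (1 / (Real.exp y - 1) - 1 / y) := by
  obtain ⟨ξ, hξ, h⟩ := exists_hasDerivAt_eq_slope
    (fun x => Real.log (1 - Real.exp (-x)) - Real.log x)
    (fun x => 1 / (Real.exp x - 1) - 1 / x) hxy
    (fun z hz => (hasDerivAt_log_one_sub_exp_neg_sub_log
      (hx.trans_le hz.1)).continuousAt.continuousWithinAt)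
    fun z hz => hasDerivAt_log_one_sub_exp_neg_sub_log (hx.trans hz.1)
  have hξ0 : 0 < ξ := hx.trans hξ.1
  have hyx : 0 < y - x := sub_pos.2 hxy
  rw [eq_div_iff hyx.ne'] at h
  rw [← h, mul_comm _ (y - x)]
  exact ⟨mul_le_mul_of_nonneg_left
      (monotoneOn_inv_exp_sub_one_sub_inv (Set.mem_Ioi.2 hx) (Set.mem_Ioi.2 hξ0) hξ.1.le) hyx.le,
    mul_le_mul_of_nonneg_left
      (monotoneOn_inv_exp_sub_one_sub_inv (Set.mem_Ioi.2 hξ0)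
        (Set.mem_Ioi.2 (hx.trans hxy)) hξ.2.le) hyx.le⟩

theorem hasSum_sigmaSum_zero_zero {α : ℝ} (hα : 0 < α) :
    HasSum (fun r : ℕ => 1 / (Real.exp (α * (r + 1)) - 1)) (sigmaSum 0 0 α) := by
  have hr := norm_exp_neg_lt_one hα
  have e : ∀ r : ℕ, 1 / (Real.exp (α * (r + 1)) - 1) =
      ((r + 1 : ℕ) : ℝ) ^ 0 * Real.exp (-α) ^ (r + 1) / (1 - Real.exp (-α) ^ (r + 1)) := by
    intro r
    rw [pow_zero, one_mul, ← exp_neg_mul_eq_pow, exp_neg_div_one_sub_exp_neg]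
    push_cast; rfl
  have hs : Summable fun r : ℕ => ((r + 1 : ℕ) : ℝ) ^ 0 * Real.exp (-α) ^ (r + 1) /
      (1 - Real.exp (-α) ^ (r + 1)) :=
    (summable_nat_add_iff (f := fun n : ℕ => (n : ℝ) ^ 0 * Real.exp (-α) ^ n /
      (1 - Real.exp (-α) ^ n)) 1).2 (summable_norm_pow_mul_geometric_div_one_sub 0 hr)
  have h := tsum_pnat_eq_tsum_succ (f := fun n : ℕ => (n : ℝ) ^ 0 * Real.exp (-α) ^ n /
      (1 - Real.exp (-α) ^ n))
  rw [tsum_pow_div_one_sub_eq_tsum_sigma hr 0, ← sigmaSum_zero_eq_tsum_pnat] at h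
  rw [h, funext e]
  exact hs.hasSum

theorem log_one_sub_exp_neg_sub_log_bounds {x : ℝ} (hx : 0 < x) :
    -x ≤ Real.log (1 - Real.exp (-x)) - Real.log x ∧
      Real.log (1 - Real.exp (-x)) - Real.log x ≤ 0 := by
  have h1 := one_sub_exp_neg_pos hx
  constructor
  · have h : x * Real.exp (-x) ≤ 1 - Real.exp (-x) := by
      have h2 := Real.add_one_le_exp x
      have h3 : Real.exp x * Real.exp (-x) = 1 := by rw [← Real.exp_add]; simp
      nlinarith [Real.exp_pos (-x)]
    have := Real.log_le_log (mul_pos hx (Real.exp_pos _)) h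
    rw [Real.log_mul hx.ne' (Real.exp_pos _).ne', Real.log_exp] at this
    linarith
  · have := Real.add_one_le_exp (-x)
    have := Real.log_le_log h1 (show 1 - Real.exp (-x) ≤ x by linarith)
    linarith

theorem tendsto_log_one_sub_exp_neg_mul {α : ℝ} (hα : 0 < α) :
    Tendsto (fun N : ℕ => Real.log (1 - Real.exp (-(α * (N : ℝ))))) atTop (𝓝 0) := by
  have h1 : Tendsto (fun N : ℕ => Real.exp (-(α * (N : ℝ)))) atTop (𝓝 0) :=
    Real.tendsto_exp_neg_atTop_nhds_zero.comp
      (tendsto_natCast_atTop_atTop.const_mul_atTop hα)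
  have h2 := (h1.const_sub 1).log (by norm_num)
  simpa using h2

/-- The Lambert series `∑ₖ d(k) e^{-αk}` equals `(γ - log α)/α` up to an error at most `1`. -/
theorem abs_sigmaSum_zero_zero_sub_le {α : ℝ} (hα : 0 < α) :
    |sigmaSum 0 0 α - (Real.eulerMascheroniConstant - Real.log α) / α| ≤ 1 := by
  set Ψ : ℝ → ℝ := fun x => Real.log (1 - Real.exp (-x)) - Real.log x with hΨ
  set f : ℕ → ℝ := fun r => 1 / (Real.exp (α * (r + 1)) - 1) with hf
  have hpos : ∀ r : ℕ, 0 < α * ((r : ℝ) + 1) := fun r => by positivity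
  -- Removing the pole `1/x` from `1/(e^x - 1)` leaves `Ψ'`. Its sums telescope in `Ψ`, while the
  -- poles sum to `harmonic N / α`.
  have hstep : ∀ r : ℕ, α * (f r - 1 / (α * (r + 1))) ≤ Ψ (α * (r + 2)) - Ψ (α * (r + 1)) ∧
      Ψ (α * (r + 2)) - Ψ (α * (r + 1)) ≤ α * (f (r + 1) - 1 / (α * (r + 2))) := by
    intro r
    have := slope_log_one_sub_exp_neg_bounds (hpos r)
      (show α * ((r : ℝ) + 1) < α * (r + 2) by gcongr; norm_num)
    have e : α * ((r : ℝ) + 2) - α * (r + 1) = α := by ring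
    rw [e] at this
    have e2 : α * (((r + 1 : ℕ) : ℝ) + 1) = α * (r + 2) := by push_cast; ring
    simp only [hf, hΨ, e2]
    exact this
  have hharm : ∀ N : ℕ, ∑ r ∈ Finset.range N, 1 / (α * ((r : ℝ) + 1)) = harmonic N / α := by
    intro N
    rw [harmonic, Rat.cast_sum, Finset.sum_div]
    refine Finset.sum_congr rfl fun r _ => ?_
    push_cast
    field_simp
  have hupper : ∀ N : ℕ, ∑ r ∈ Finset.range N, f r ≤
      (harmonic N + Ψ (α * (N + 1))) / α + 1 := by
    intro N
    have h : ∑ r ∈ Finset.range N, α * (f r - 1 / (α * (r + 1))) ≤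
        Ψ (α * (N + 1)) - Ψ α := by
      have := Finset.sum_range_sub (fun r : ℕ => Ψ (α * (r + 1))) N
      simp only [Nat.cast_zero, zero_add, mul_one] at this
      rw [← this]
      refine Finset.sum_le_sum fun r _ => (hstep r).1.trans (le_of_eq ?_)
      push_cast; ring_nf
    rw [← Finset.mul_sum, Finset.sum_sub_distrib, hharm] at h
    have h2 := (log_one_sub_exp_neg_sub_log_bounds hα).1
    have h3 : α * (∑ r ∈ Finset.range N, f r - harmonic N / α) ≤ Ψ (α * (N + 1)) + α := by
      linarith
    rw [← sub_le_iff_le_add, le_div_iff₀ hα]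
    have : α * (harmonic N / α) = harmonic N := by field_simp
    linarith
  have hlower : ∀ N : ℕ, (harmonic (N + 1) + Ψ (α * (N + 1))) / α - 1 ≤
      ∑ r ∈ Finset.range (N + 1), f r := by
    intro N
    have h : Ψ (α * (N + 1)) - Ψ α ≤
        ∑ r ∈ Finset.range N, α * (f (r + 1) - 1 / (α * (r + 2))) := by
      have := Finset.sum_range_sub (fun r : ℕ => Ψ (α * (r + 1))) N
      simp only [Nat.cast_zero, zero_add, mul_one] at this
      rw [← this]
      refine Finset.sum_le_sum fun r _ => (le_of_eq ?_).trans (hstep r).2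
      push_cast; ring_nf
    -- The lower comparison starts at the second term; the first is bounded directly by `1 - e^{-α}
    -- ≤ α`.
    have h0 : -α ≤ α * (f 0 - 1 / (α * ((0 : ℕ) + 1))) := by
      have h1 := Real.add_one_le_exp (-α)
      have h2 : 1 / α ≤ 1 / (1 - Real.exp (-α)) :=
        one_div_le_one_div_of_le (one_sub_exp_neg_pos hα) (by linarith)
      have h3 : 1 / (1 - Real.exp (-α)) = f 0 + 1 := by
        simp only [hf, Nat.cast_zero, zero_add, mul_one, ← exp_neg_div_one_sub_exp_neg]
        have := one_sub_exp_neg_pos hα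
        field_simp
        ring
      rw [Nat.cast_zero, zero_add, mul_one]
      nlinarith
    have h2 := (log_one_sub_exp_neg_sub_log_bounds hα).2
    have h3 : ∑ r ∈ Finset.range (N + 1), α * (f r - 1 / (α * (r + 1))) =
        ∑ r ∈ Finset.range N, α * (f (r + 1) - 1 / (α * (r + 2))) +
          α * (f 0 - 1 / (α * ((0 : ℕ) + 1))) := by
      rw [Finset.sum_range_succ']
      congr 1
      refine Finset.sum_congr rfl fun r _ => ?_
      push_cast; ring_nf
    rw [← Finset.mul_sum, Finset.sum_sub_distrib, hharm] at h3
    rw [sub_le_iff_le_add, div_le_iff₀ hα]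
    have : α * (harmonic (N + 1) / α) = harmonic (N + 1) := by field_simp
    have h4 : Ψ α ≤ 0 := h2
    linarith
  have hsum := (hasSum_sigmaSum_zero_zero hα).tendsto_sum_nat
  -- The term `-log(N+1)` pairs with `harmonic (N+1)` below and `harmonic N` above; both differences
  -- tend to `γ`.
  have hlog : ∀ N : ℕ, Ψ (α * (N + 1)) = Real.log (1 - Real.exp (-(α * ((N + 1 : ℕ) : ℝ)))) -
      Real.log α - Real.log (N + 1) := by
    intro N
    simp only [hΨ]
    rw [Real.log_mul hα.ne' (by positivity)]
    push_cast; ring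
  have hlim := (tendsto_add_atTop_iff_nat 1).2 (tendsto_log_one_sub_exp_neg_mul hα)
  rw [abs_le]
  constructor
  · have h1 : Tendsto (fun N : ℕ => (harmonic (N + 1) + Ψ (α * (N + 1))) / α - 1) atTop
        (𝓝 ((Real.eulerMascheroniConstant - Real.log α) / α - 1)) := by
      have h2 := (tendsto_add_atTop_iff_nat 1).2 Real.tendsto_eulerMascheroniSeq'
      have h3 := (((h2.add hlim).sub_const (Real.log α)).div_const α).sub_const 1
      rw [add_zero] at h3
      refine h3.congr fun N => ?_
      rw [hlog, Real.eulerMascheroniSeq']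
      simp only [Nat.add_eq_zero_iff, one_ne_zero, and_false, if_false]
      push_cast; ring
    have := le_of_tendsto_of_tendsto' h1 ((tendsto_add_atTop_iff_nat 1).2 hsum) hlower
    linarith
  · have h1 : Tendsto (fun N : ℕ => (harmonic N + Ψ (α * (N + 1))) / α + 1) atTop
        (𝓝 ((Real.eulerMascheroniConstant - Real.log α) / α + 1)) := by
      have h3 := (((Real.tendsto_eulerMascheroniSeq.add hlim).sub_const
        (Real.log α)).div_const α).add_const 1
      rw [add_zero] at h3
      refine h3.congr fun N => ?_
      rw [hlog, Real.eulerMascheroniSeq]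
      push_cast; ring
    have := le_of_tendsto_of_tendsto' hsum h1 hupper
    linarith

/-! ### Tilted partition numbers -/

/-- The number of partitions of `m`, weighted by `e^{-αm}`. -/
noncomputable def tiltedPartitions (α : ℝ) (m : ℕ) : ℝ :=
  numPartitions m * Real.exp (-(α * m))

theorem tiltedPartitions_pos (α : ℝ) (m : ℕ) : 0 < tiltedPartitions α m :=
  mul_pos (by exact_mod_cast numPartitions_pos m) (Real.exp_pos _)

open Finset in
theorem sum_antidiagonal_mul_tiltedPartitions (α : ℝ) (u : ℕ → ℕ) (n : ℕ) :
    ((∑ x ∈ antidiagonal n, u x.1 * numPartitions x.2 : ℕ) : ℝ) * Real.exp (-(α * n)) =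
      ∑ x ∈ antidiagonal n, u x.1 * Real.exp (-(α * x.1)) * tiltedPartitions α x.2 := by
  push_cast
  rw [Finset.sum_mul]
  refine Finset.sum_congr rfl fun x hx => ?_
  have : Real.exp (-(α * n)) = Real.exp (-(α * x.1)) * Real.exp (-(α * x.2)) := by
    rw [← Real.exp_add, ← HasAntidiagonal.mem_antidiagonal.1 hx]; push_cast; ring_nf
  rw [this, tiltedPartitions]
  ring

open Finset in
theorem mul_tiltedPartitions (α : ℝ) (n : ℕ) :
    n * tiltedPartitions α n =
      ∑ x ∈ antidiagonal n, sigma 1 x.1 * Real.exp (-(α * x.1)) * tiltedPartitions α x.2 := by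
  rw [← sum_antidiagonal_mul_tiltedPartitions, ← mul_numPartitions, tiltedPartitions]
  push_cast; ring

/-- The recurrence alone controls growth: once `m ≥ S_{1,0}`, it shows that a bound `C` for the
earlier values persists at `m`. -/
theorem exists_tiltedPartitions_le {α : ℝ} (hα : 0 < α) :
    ∃ C : ℝ, ∀ m, tiltedPartitions α m ≤ C := by
  set N := ⌈sigmaSum 1 0 α⌉₊ with hN
  refine ⟨∑ m ∈ Finset.range (N + 1), tiltedPartitions α m, fun m => ?_⟩
  set C := ∑ m ∈ Finset.range (N + 1), tiltedPartitions α m with hC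
  have hC0 : 0 ≤ C := Finset.sum_nonneg fun m _ => (tiltedPartitions_pos α m).le
  induction m using Nat.strong_induction_on with
  | _ m ih =>
    by_cases hm : m < N + 1
    · exact Finset.single_le_sum (f := tiltedPartitions α)
        (fun i _ => (tiltedPartitions_pos α i).le) (Finset.mem_range.2 hm)
    · have hmpos : (0 : ℝ) < m := by exact_mod_cast (show 0 < m by omega)
      have h1 : m * tiltedPartitions α m ≤ sigmaSum 1 0 α * C := by
        rw [mul_tiltedPartitions, Finset.Nat.sum_antidiagonal_eq_sum_range_succ_mk]
        have h2 : ∑ k ∈ Finset.range m.succ, sigma 1 k * Real.exp (-(α * k)) *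
            tiltedPartitions α (m - k) ≤
            ∑ k ∈ Finset.range m.succ, sigma 1 k * Real.exp (-(α * k)) * C := by
          refine Finset.sum_le_sum fun k hk => ?_
          -- The term `k = 0`, where induction is unavailable, vanishes because `σ(0) = 0`.
          rcases Nat.eq_zero_or_pos k with rfl | hk0
          · simp
          · have := ih (m - k) (by omega)
            gcongr
        refine h2.trans ?_
        rw [← Finset.sum_mul]
        gcongr
        have h3 := summable_sigmaSum 1 0 hα
        simp only [pow_zero, one_mul] at h3
        have := h3.sum_le_tsum (Finset.range m.succ) fun k _ => by positivity
        simpa [sigmaSum] using this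
      have h4 : sigmaSum 1 0 α ≤ m :=
        (Nat.le_ceil _).trans (by exact_mod_cast (show N ≤ m by omega))
      have h5 : (m : ℝ) * tiltedPartitions α m ≤ m * C := h1.trans (by gcongr)
      exact le_of_mul_le_mul_left h5 hmpos

theorem summable_pow_mul_tiltedPartitions (j : ℕ) {α : ℝ} (hα : 0 < α) :
    Summable fun m : ℕ => (m : ℝ) ^ j * tiltedPartitions α m := by
  obtain ⟨C, hC⟩ := exists_tiltedPartitions_le (half_pos hα)
  refine ((summable_pow_mul_exp_neg j (half_pos hα)).mul_left C).of_nonneg_of_le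
    (fun m => mul_nonneg (by positivity) (tiltedPartitions_pos α m).le) fun m => ?_
  have e : tiltedPartitions α m = tiltedPartitions (α / 2) m * Real.exp (-(α / 2 * m)) := by
    rw [tiltedPartitions, tiltedPartitions, mul_assoc, ← Real.exp_add]; ring_nf
  rw [e]
  have := mul_le_mul_of_nonneg_left (hC m)
    (show 0 ≤ (m : ℝ) ^ j * Real.exp (-(α / 2 * m)) by positivity)
  linarith

theorem summable_tiltedPartitions {α : ℝ} (hα : 0 < α) : Summable (tiltedPartitions α) := by
  simpa using summable_pow_mul_tiltedPartitions 0 hα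

/-! ### The generating function on a circle -/

/-- The absolutely convergent trigonometric series `∑ₖ cₖ e^{ikθ}`. -/
noncomputable def trigSum (c : ℕ → ℝ) (θ : ℝ) : ℂ :=
  ∑' k : ℕ, (c k : ℂ) * Complex.exp ((k * θ : ℝ) * Complex.I)

theorem norm_trigSum_term (c : ℕ → ℝ) (θ : ℝ) (k : ℕ) :
    ‖(c k : ℂ) * Complex.exp ((k * θ : ℝ) * Complex.I)‖ = |c k| := by
  rw [norm_mul, Complex.norm_exp_ofReal_mul_I, mul_one, Complex.norm_real, Real.norm_eq_abs]

theorem summable_norm_trigSum {c : ℕ → ℝ} (hc : Summable c) (θ : ℝ) :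
    Summable fun k : ℕ => ‖(c k : ℂ) * Complex.exp ((k * θ : ℝ) * Complex.I)‖ := by
  simpa only [norm_trigSum_term] using hc.abs

theorem hasDerivAt_trigSum {c : ℕ → ℝ} (hc : Summable c) (hc' : Summable fun k : ℕ => k * c k)
    (θ : ℝ) : HasDerivAt (trigSum c) (Complex.I * trigSum (fun k => k * c k) θ) θ := by
  have h : HasDerivAt (fun z : ℝ => ∑' k : ℕ, (c k : ℂ) * Complex.exp ((k * z : ℝ) * Complex.I))
      (∑' k : ℕ, Complex.I * (((k * c k : ℝ) : ℂ) * Complex.exp ((k * θ : ℝ) * Complex.I))) θ := by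
    refine hasDerivAt_tsum (y₀ := 0) (u := fun k : ℕ => |k * c k|)
      (g' := fun k z => Complex.I * (((k * c k : ℝ) : ℂ) * Complex.exp ((k * z : ℝ) * Complex.I)))
      hc'.abs (fun k z => ?_) (fun k z => ?_)
      (summable_norm_trigSum hc 0).of_norm θ
    · have h1 : HasDerivAt (fun z : ℝ => ((k * z : ℝ) : ℂ) * Complex.I) (k * Complex.I) z := by
        have h0 : HasDerivAt (fun z : ℝ => k * z) (k : ℝ) z := by
          simpa using (hasDerivAt_id z).const_mul (k : ℝ)
        simpa using h0.ofReal_comp.mul_const Complex.I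
      refine (h1.cexp.const_mul (c k : ℂ)).congr_deriv ?_
      push_cast; ring
    · rw [norm_mul, Complex.norm_I, one_mul, norm_trigSum_term (fun k : ℕ => k * c k)]
  rw [tsum_mul_left] at h
  exact h

theorem continuous_trigSum {c : ℕ → ℝ} (hc : Summable c) : Continuous (trigSum c) :=
  continuous_tsum (fun k => by fun_prop) hc.abs fun k θ => (norm_trigSum_term c θ k).le

theorem re_trigSum {c : ℕ → ℝ} (hc : Summable c) (θ : ℝ) :
    (trigSum c θ).re = ∑' k : ℕ, c k * Real.cos (k * θ) := by
  rw [trigSum, Complex.re_tsum (summable_norm_trigSum hc θ).of_norm]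
  refine tsum_congr fun k => ?_
  rw [Complex.re_ofReal_mul, Complex.exp_ofReal_mul_I_re]

theorem im_trigSum {c : ℕ → ℝ} (hc : Summable c) (θ : ℝ) :
    (trigSum c θ).im = ∑' k : ℕ, c k * Real.sin (k * θ) := by
  rw [trigSum, Complex.im_tsum (summable_norm_trigSum hc θ).of_norm]
  refine tsum_congr fun k => ?_
  rw [Complex.im_ofReal_mul, Complex.exp_ofReal_mul_I_im]

open Finset in
theorem trigSum_mul_trigSum {c d : ℕ → ℝ} (hc : Summable c) (hd : Summable d) (θ : ℝ) :
    trigSum c θ * trigSum d θ =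
      trigSum (fun n => ∑ x ∈ antidiagonal n, c x.1 * d x.2) θ := by
  rw [trigSum, trigSum, tsum_mul_tsum_eq_tsum_sum_antidiagonal_of_summable_norm
    (summable_norm_trigSum hc θ) (summable_norm_trigSum hd θ), trigSum]
  refine tsum_congr fun n => ?_
  push_cast
  rw [Finset.sum_mul]
  refine Finset.sum_congr rfl fun x hx => ?_
  have : Complex.exp (n * θ * Complex.I) =
      Complex.exp (x.1 * θ * Complex.I) * Complex.exp (x.2 * θ * Complex.I) := by
    rw [← Complex.exp_add, ← HasAntidiagonal.mem_antidiagonal.1 hx]; push_cast; ring_nf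
  rw [this]
  ring

/-- The coefficients `σ(k) e^{-αk} / k` of the logarithm of the partition generating function. -/
noncomputable def logCoeff (α : ℝ) (k : ℕ) : ℝ := sigma 1 k / k * Real.exp (-(α * k))

theorem logCoeff_nonneg (α : ℝ) (k : ℕ) : 0 ≤ logCoeff α k := by
  unfold logCoeff; positivity

theorem mul_logCoeff (α : ℝ) (k : ℕ) :
    k * logCoeff α k = sigma 1 k * Real.exp (-(α * k)) := by
  rcases Nat.eq_zero_or_pos k with rfl | hk
  · simp
  · have : (k : ℝ) ≠ 0 := by positivity
    rw [logCoeff]; field_simp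

theorem pow_succ_mul_logCoeff (α : ℝ) (j k : ℕ) :
    (k : ℝ) ^ (j + 1) * logCoeff α k = (k : ℝ) ^ j * sigma 1 k * Real.exp (-(α * k)) := by
  rw [pow_succ, mul_assoc, mul_logCoeff, mul_assoc]

theorem summable_pow_succ_mul_logCoeff (j : ℕ) {α : ℝ} (hα : 0 < α) :
    Summable fun k : ℕ => (k : ℝ) ^ (j + 1) * logCoeff α k := by
  simpa only [pow_succ_mul_logCoeff] using summable_sigmaSum 1 j hα

theorem tsum_pow_succ_mul_logCoeff (j : ℕ) (α : ℝ) :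
    ∑' k : ℕ, (k : ℝ) ^ (j + 1) * logCoeff α k = sigmaSum 1 j α := by
  simp only [pow_succ_mul_logCoeff, sigmaSum]

theorem summable_logCoeff {α : ℝ} (hα : 0 < α) : Summable (logCoeff α) := by
  refine (summable_pow_succ_mul_logCoeff 0 hα).of_nonneg_of_le (logCoeff_nonneg α) fun k => ?_
  rcases Nat.eq_zero_or_pos k with rfl | hk
  · simp [logCoeff]
  · have : (1 : ℝ) ≤ k := by exact_mod_cast hk
    have := logCoeff_nonneg α k
    simp only [zero_add, pow_one]
    nlinarith

/-- The exponential formula for the partition generating function on the circle of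
radius `e^{-α}`. -/
theorem trigSum_tiltedPartitions {α : ℝ} (hα : 0 < α) (θ : ℝ) :
    trigSum (tiltedPartitions α) θ = (∑' m, tiltedPartitions α m : ℝ) *
      Complex.exp (trigSum (logCoeff α) θ - (∑' k, logCoeff α k : ℝ)) := by
  have hs := summable_tiltedPartitions hα
  have hs' : Summable fun k : ℕ => k * tiltedPartitions α k := by
    simpa using summable_pow_mul_tiltedPartitions 1 hα
  have hl := summable_logCoeff hα
  have hl' : Summable fun k : ℕ => k * logCoeff α k := by
    simpa using summable_pow_succ_mul_logCoeff 0 hα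
  have h0 : ∀ c : ℕ → ℝ, trigSum c 0 = (∑' k, c k : ℝ) := by
    intro c; simp [trigSum, Complex.ofReal_tsum]
  -- The recurrence is the differential equation `Φ' = ℓ' Φ`, where `ℓ` is the series of `logCoeff`;
  -- hence `Φ e^{-ℓ}` is constant.
  have hmul : ∀ θ, trigSum (fun k => k * tiltedPartitions α k) θ =
      trigSum (fun k => k * logCoeff α k) θ * trigSum (tiltedPartitions α) θ := by
    intro θ
    rw [trigSum_mul_trigSum hl' hs]
    congr 1
    ext n
    rw [mul_tiltedPartitions]
    simp only [mul_logCoeff]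
  have hd : ∀ θ, HasDerivAt (fun θ => trigSum (tiltedPartitions α) θ *
      Complex.exp (-trigSum (logCoeff α) θ)) 0 θ := by
    intro θ
    refine ((hasDerivAt_trigSum hs hs' θ).mul
      (hasDerivAt_trigSum hl hl' θ).neg.cexp).congr_deriv ?_
    rw [hmul]; ring
  have hconst := is_const_of_deriv_eq_zero (fun θ => (hd θ).differentiableAt)
    (fun θ => (hd θ).deriv) θ 0
  simp only [h0] at hconst
  have h1 : trigSum (tiltedPartitions α) θ = trigSum (tiltedPartitions α) θ *
      Complex.exp (-trigSum (logCoeff α) θ) * Complex.exp (trigSum (logCoeff α) θ) := by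
    rw [mul_assoc, ← Complex.exp_add]; simp
  rw [h1, hconst, mul_assoc, ← Complex.exp_add]
  ring_nf

theorem norm_trigSum_tiltedPartitions {α : ℝ} (hα : 0 < α) (θ : ℝ) :
    ‖trigSum (tiltedPartitions α) θ‖ = (∑' m, tiltedPartitions α m) *
      Real.exp (-∑' k : ℕ, logCoeff α k * (1 - Real.cos (k * θ))) := by
  have hl := summable_logCoeff hα
  have hl2 : Summable fun k : ℕ => logCoeff α k * Real.cos (k * θ) :=
    hl.of_norm_bounded fun k => by
      rw [norm_mul, Real.norm_of_nonneg (logCoeff_nonneg α k)]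
      exact mul_le_of_le_one_right (logCoeff_nonneg α k) (Real.abs_cos_le_one _)
  rw [trigSum_tiltedPartitions hα, norm_mul, Complex.norm_exp, Complex.norm_real,
    Real.norm_of_nonneg (tsum_nonneg fun m => (tiltedPartitions_pos α m).le), Complex.sub_re,
    Complex.ofReal_re, re_trigSum hl]
  simp_rw [mul_sub, mul_one]
  rw [hl.tsum_sub hl2, neg_sub]

theorem re_trigSum_tiltedPartitions_mul_exp {α : ℝ} (hα : 0 < α) (n : ℕ) (θ : ℝ) :
    (trigSum (tiltedPartitions α) θ * Complex.exp ((-(n * θ) : ℝ) * Complex.I)).re =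
      ‖trigSum (tiltedPartitions α) θ‖ *
        Real.cos (∑' k : ℕ, logCoeff α k * Real.sin (k * θ) - n * θ) := by
  have hl := summable_logCoeff hα
  rw [trigSum_tiltedPartitions hα, norm_mul, Complex.norm_exp, Complex.norm_real,
    Real.norm_of_nonneg (tsum_nonneg fun m => (tiltedPartitions_pos α m).le), mul_assoc,
    ← Complex.exp_add, Complex.re_ofReal_mul, Complex.exp_re, ← im_trigSum hl, mul_assoc]
  simp [sub_eq_add_neg]

/-! ### Phase and decay of the generating function -/

theorem abs_tsum_logCoeff_mul_sin_sub_le {α : ℝ} (hα : 0 < α) (θ : ℝ) :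
    |∑' k : ℕ, logCoeff α k * Real.sin (k * θ) - sigmaSum 1 0 α * θ| ≤
      sigmaSum 1 2 α * |θ| ^ 3 / 6 := by
  have h1 : Summable fun k : ℕ => logCoeff α k * Real.sin (k * θ) :=
    (summable_logCoeff hα).of_norm_bounded fun k => by
      rw [norm_mul, Real.norm_of_nonneg (logCoeff_nonneg α k)]
      exact mul_le_of_le_one_right (logCoeff_nonneg α k) (Real.abs_sin_le_one _)
  have h2 := (summable_pow_succ_mul_logCoeff 0 hα).mul_right θ
  have h3 := (summable_pow_succ_mul_logCoeff 2 hα).mul_right (|θ| ^ 3 / 6)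
  rw [← tsum_pow_succ_mul_logCoeff 0, ← tsum_pow_succ_mul_logCoeff 2, ← tsum_mul_right,
    ← h1.tsum_sub h2, mul_div_assoc, ← tsum_mul_right, ← Real.norm_eq_abs]
  refine tsum_of_norm_bounded h3.hasSum fun k => ?_
  have h := Real.abs_sub_sin_le (k * θ)
  have e : logCoeff α k * Real.sin (k * θ) - (k : ℝ) ^ (0 + 1) * logCoeff α k * θ =
      -(logCoeff α k * (k * θ - Real.sin (k * θ))) := by ring
  rw [e, norm_neg, norm_mul, Real.norm_of_nonneg (logCoeff_nonneg α k), Real.norm_eq_abs]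
  calc logCoeff α k * |k * θ - Real.sin (k * θ)|
      ≤ logCoeff α k * (|k * θ| ^ 3 / 6) := by
        gcongr
        exact logCoeff_nonneg α k
    _ = _ := by rw [abs_mul, Nat.abs_cast]; ring

theorem tsum_logCoeff_mul_one_sub_cos_le {α : ℝ} (hα : 0 < α) (θ : ℝ) :
    ∑' k : ℕ, logCoeff α k * (1 - Real.cos (k * θ)) ≤ sigmaSum 1 1 α * θ ^ 2 / 2 := by
  have h3 := (summable_pow_succ_mul_logCoeff 1 hα).mul_right (θ ^ 2 / 2)
  have hle : ∀ k : ℕ, logCoeff α k * (1 - Real.cos (k * θ)) ≤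
      (k : ℝ) ^ (1 + 1) * logCoeff α k * (θ ^ 2 / 2) := by
    intro k
    have := Real.one_sub_sq_div_two_le_cos (x := k * θ)
    have := mul_le_mul_of_nonneg_left (show 1 - Real.cos (k * θ) ≤ (k * θ) ^ 2 / 2 by linarith)
      (logCoeff_nonneg α k)
    linarith
  have hnn : ∀ k : ℕ, 0 ≤ logCoeff α k * (1 - Real.cos (k * θ)) := fun k =>
    mul_nonneg (logCoeff_nonneg α k) (sub_nonneg.2 (Real.cos_le_one _))
  rw [← tsum_pow_succ_mul_logCoeff 1, mul_div_assoc, ← tsum_mul_right]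
  exact (h3.of_nonneg_of_le hnn hle).tsum_le_tsum hle h3

theorem tsum_exp_neg_mul_one_sub_cos {α : ℝ} (hα : 0 < α) (θ : ℝ) :
    ∑' k : ℕ, Real.exp (-(α * k)) * (1 - Real.cos (k * θ)) =
      Real.exp (-α) * (1 + Real.exp (-α)) * (1 - Real.cos θ) / ((1 - Real.exp (-α)) *
        ((1 - Real.exp (-α)) ^ 2 + 2 * Real.exp (-α) * (1 - Real.cos θ))) := by
  have hs : Summable fun k : ℕ => Real.exp (-(α * k)) := by
    simpa using summable_pow_mul_exp_neg 0 hα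
  have hs2 : Summable fun k : ℕ => Real.exp (-(α * k)) * Real.cos (k * θ) :=
    hs.of_norm_bounded fun k => by
      rw [norm_mul, Real.norm_of_nonneg (Real.exp_pos _).le]
      exact mul_le_of_le_one_right (Real.exp_pos _).le (Real.abs_cos_le_one _)
  simp_rw [mul_sub, mul_one]
  rw [hs.tsum_sub hs2, ← re_trigSum hs]
  have hlt := norm_exp_neg_lt_one hα
  set r := Real.exp (-α) with hr
  have hr0 : 0 < r := Real.exp_pos _
  have hr1 : 0 < 1 - r := one_sub_exp_neg_pos hα
  have h1 : ∑' k : ℕ, Real.exp (-(α * k)) = (1 - r)⁻¹ := by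
    simp_rw [exp_neg_mul_eq_pow]
    exact tsum_geometric_of_norm_lt_one hlt
  have h2 : trigSum (fun k : ℕ => Real.exp (-(α * k))) θ =
      (1 - r * Complex.exp (θ * Complex.I))⁻¹ := by
    rw [← tsum_geometric_of_norm_lt_one, trigSum]
    · refine tsum_congr fun k => ?_
      rw [exp_neg_mul_eq_pow, ← hr, mul_pow, ← Complex.exp_nat_mul]
      push_cast; ring_nf
    · rw [norm_mul, Complex.norm_exp_ofReal_mul_I, mul_one, Complex.norm_real]
      exact hlt
  have hD : 0 < (1 - r) ^ 2 + 2 * r * (1 - Real.cos θ) := by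
    have := Real.cos_le_one θ
    have : 0 ≤ 2 * r * (1 - Real.cos θ) := mul_nonneg (by positivity) (by linarith)
    positivity
  have hns : Complex.normSq (1 - r * Complex.exp (θ * Complex.I)) =
      (1 - r) ^ 2 + 2 * r * (1 - Real.cos θ) := by
    rw [Complex.normSq_apply, Complex.sub_re, Complex.sub_im, Complex.re_ofReal_mul,
      Complex.im_ofReal_mul, Complex.exp_ofReal_mul_I_re, Complex.exp_ofReal_mul_I_im]
    simp only [Complex.one_re, Complex.one_im]
    linear_combination r ^ 2 * Real.sin_sq_add_cos_sq θ
  rw [h1, h2, Complex.inv_re, hns, Complex.sub_re, Complex.re_ofReal_mul,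
    Complex.exp_ofReal_mul_I_re, Complex.one_re]
  rw [inv_eq_one_div, div_sub_div _ _ hr1.ne' hD.ne']
  congr 1 <;> ring

/-- Since `σ(k) ≥ k`, discarding the excess leaves a geometric series, which still gives enough
decay over the whole period. -/
theorem tsum_exp_le_tsum_logCoeff {α : ℝ} (hα : 0 < α) (θ : ℝ) :
    ∑' k : ℕ, Real.exp (-(α * k)) * (1 - Real.cos (k * θ)) ≤
      ∑' k : ℕ, logCoeff α k * (1 - Real.cos (k * θ)) := by
  have hnn : ∀ k : ℕ, 0 ≤ 1 - Real.cos (k * θ) := fun k => sub_nonneg.2 (Real.cos_le_one _)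
  have h2 : ∀ k : ℕ, 1 - Real.cos (k * θ) ≤ 2 := fun k => by
    linarith [Real.neg_one_le_cos (k * θ)]
  have hle : ∀ k : ℕ, Real.exp (-(α * k)) * (1 - Real.cos (k * θ)) ≤
      logCoeff α k * (1 - Real.cos (k * θ)) := by
    intro k
    rcases Nat.eq_zero_or_pos k with rfl | hk
    · simp
    · refine mul_le_mul_of_nonneg_right ?_ (hnn k)
      have hk' : (0 : ℝ) < k := by exact_mod_cast hk
      have h : (k : ℝ) ≤ sigma 1 k := by
        have : k ≤ sigma 1 k := by
          rw [sigma_one_apply]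
          exact Finset.single_le_sum (f := fun d => d) (fun _ _ => Nat.zero_le _)
            (Nat.mem_divisors_self k hk.ne')
        exact_mod_cast this
      rw [logCoeff]
      exact le_mul_of_one_le_left (Real.exp_pos _).le ((one_le_div hk').2 h)
  have hs : Summable fun k : ℕ => logCoeff α k * (1 - Real.cos (k * θ)) :=
    ((summable_logCoeff hα).mul_right 2).of_nonneg_of_le
      (fun k => mul_nonneg (logCoeff_nonneg α k) (hnn k))
      fun k => mul_le_mul_of_nonneg_left (h2 k) (logCoeff_nonneg α k)
  exact (hs.of_nonneg_of_le (fun k => mul_nonneg (Real.exp_pos _).le (hnn k)) hle).tsum_le_tsum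
    hle hs

theorem le_tsum_logCoeff_mul_one_sub_cos {α θ : ℝ} (hα : 0 < α) (h6 : α ≤ 1 / 6)
    (hθ : |θ| ≤ Real.pi) :
    θ ^ 2 / (4 * (α * (α ^ 2 + θ ^ 2))) ≤
      ∑' k : ℕ, logCoeff α k * (1 - Real.cos (k * θ)) := by
  refine le_trans ?_ (tsum_exp_le_tsum_logCoeff hα θ)
  rw [tsum_exp_neg_mul_one_sub_cos hα]
  set r := Real.exp (-α) with hr
  have hr0 : 0 < r := Real.exp_pos _
  have hr1 : 0 < 1 - r := one_sub_exp_neg_pos hα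
  have hra : 1 - r ≤ α := by have := Real.add_one_le_exp (-α); linarith
  have hc := Real.cos_le_one_sub_mul_cos_sq hθ
  have hc' := Real.one_sub_sq_div_two_le_cos (x := θ)
  have hc1 : θ ^ 2 / 5 ≤ 1 - Real.cos θ := by
    have : 1 / 5 ≤ 2 / Real.pi ^ 2 := by
      rw [div_le_div_iff₀ (by norm_num) (by positivity)]
      nlinarith [Real.pi_lt_d2, Real.pi_pos]
    nlinarith [sq_nonneg θ]
  have hc0 : 0 ≤ 1 - Real.cos θ := by linarith [Real.cos_le_one θ]
  have hD : (1 - r) ^ 2 + 2 * r * (1 - Real.cos θ) ≤ α ^ 2 + θ ^ 2 := by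
    have h1 : (1 - r) ^ 2 ≤ α ^ 2 := by gcongr
    have h2 : r * (1 - Real.cos θ) ≤ 1 * (θ ^ 2 / 2) :=
      mul_le_mul (by linarith) (by linarith) hc0 zero_le_one
    linarith
  have hN : θ ^ 2 / 4 ≤ r * (1 + r) * (1 - Real.cos θ) := by
    have h1 : 5 / 4 ≤ r * (1 + r) := by nlinarith
    have := mul_le_mul h1 hc1 (by positivity) (by positivity)
    linarith
  have hDpos : 0 < (1 - r) ^ 2 + 2 * r * (1 - Real.cos θ) := by
    have : 0 ≤ 2 * r * (1 - Real.cos θ) := mul_nonneg (by positivity) hc0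
    positivity
  rw [← div_div]
  gcongr

/-- The total mass `∑ₘ p(m) e^{-αm}`. -/
noncomputable def partitionMass (α : ℝ) : ℝ := ∑' m, tiltedPartitions α m

theorem partitionMass_nonneg (α : ℝ) : 0 ≤ partitionMass α :=
  tsum_nonneg fun m => (tiltedPartitions_pos α m).le

theorem norm_trigSum_tiltedPartitions_le {α θ : ℝ} (hα : 0 < α) (h6 : α ≤ 1 / 6)
    (hθ : |θ| ≤ Real.pi) :
    ‖trigSum (tiltedPartitions α) θ‖ ≤ partitionMass α *
      (Real.exp (-(1 / (8 * α ^ 3)) * θ ^ 2) + Real.exp (-(1 / (8 * α)))) := by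
  rw [norm_trigSum_tiltedPartitions hα]
  refine mul_le_mul_of_nonneg_left ?_ (partitionMass_nonneg α)
  have h := le_tsum_logCoeff_mul_one_sub_cos hα h6 hθ
  refine (Real.exp_le_exp.2 (neg_le_neg h)).trans ?_
  -- For `|θ| ≤ α` the exponent is at least `θ²/(8α³)`, beyond that at least `1/(8α)`.
  rcases le_total (θ ^ 2) (α ^ 2) with hle | hle
  · refine le_add_of_le_of_nonneg (Real.exp_le_exp.2 ?_) (Real.exp_pos _).le
    rw [neg_mul, neg_le_neg_iff, one_div_mul_eq_div]
    apply div_le_div_of_nonneg_left (sq_nonneg θ) (by positivity)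
    nlinarith
  · refine le_add_of_nonneg_of_le (Real.exp_pos _).le (Real.exp_le_exp.2 ?_)
    rw [neg_le_neg_iff, div_le_div_iff₀ (by positivity) (by positivity)]
    nlinarith

/-! ### The second moment -/

open MeasureTheory in
theorem intervalIntegral_gaussian_le {b : ℝ} (hb : 0 < b) :
    ∫ θ in (-Real.pi)..Real.pi, Real.exp (-b * θ ^ 2) ≤ √(Real.pi / b) := by
  rw [← integral_gaussian b, intervalIntegral.integral_of_le (by linarith [Real.pi_pos])]
  exact setIntegral_le_integral (integrable_exp_neg_mul_sq hb)
    (Eventually.of_forall fun θ => (Real.exp_pos _).le)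

/-- The integral `∫ θ² |Φ(θ)| dθ` over a period, where `Φ` is the generating function of
the weighted partition numbers. -/
noncomputable def secondMoment (α : ℝ) : ℝ :=
  ∫ θ in (-Real.pi)..Real.pi, θ ^ 2 * ‖trigSum (tiltedPartitions α) θ‖

theorem continuous_trigSum_tiltedPartitions {α : ℝ} (hα : 0 < α) :
    Continuous (trigSum (tiltedPartitions α)) :=
  continuous_trigSum (summable_tiltedPartitions hα)

theorem sq_mul_norm_trigSum_le {α θ : ℝ} (hα : 0 < α) (h6 : α ≤ 1 / 6) (hθ : |θ| ≤ Real.pi) :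
    θ ^ 2 * ‖trigSum (tiltedPartitions α) θ‖ ≤ partitionMass α *
      (16 * α ^ 3 * Real.exp (-(1 / (16 * α ^ 3)) * θ ^ 2) +
        Real.pi ^ 2 * Real.exp (-(1 / (8 * α)))) := by
  have h1 := mul_le_mul_of_nonneg_left (norm_trigSum_tiltedPartitions_le hα h6 hθ) (sq_nonneg θ)
  refine h1.trans ?_
  rw [mul_left_comm]
  refine mul_le_mul_of_nonneg_left ?_ (partitionMass_nonneg α)
  rw [mul_add]
  have h2 : θ ^ 2 ≤ Real.pi ^ 2 := by
    rw [← sq_abs]; gcongr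
  refine add_le_add ?_ (mul_le_mul_of_nonneg_right h2 (Real.exp_pos _).le)
  -- Half of the Gaussian exponent absorbs the factor `θ²`, through `y e^{-y} ≤ 1`.
  set y := 1 / (16 * α ^ 3) * θ ^ 2 with hy
  have e1 : -(1 / (8 * α ^ 3)) * θ ^ 2 = -y + -y := by rw [hy]; field_simp; ring
  have e2 : θ ^ 2 = 16 * α ^ 3 * y := by rw [hy]; field_simp
  have e3 : -(1 / (16 * α ^ 3)) * θ ^ 2 = -y := by rw [hy]; ring
  rw [e1, e3, Real.exp_add, e2]
  have h3 : y * Real.exp (-y) ≤ 1 := by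
    have := Real.add_one_le_exp y
    have h4 : Real.exp y * Real.exp (-y) = 1 := by rw [← Real.exp_add]; simp
    nlinarith [Real.exp_pos (-y)]
  calc 16 * α ^ 3 * y * (Real.exp (-y) * Real.exp (-y))
      = 16 * α ^ 3 * Real.exp (-y) * (y * Real.exp (-y)) := by ring
    _ ≤ 16 * α ^ 3 * Real.exp (-y) * 1 := by gcongr
    _ = _ := mul_one _

/-- A Gaussian of width `α^{3/2}` contributes `α³ · α^{3/2}`; the tail `e^{-1/(8α)}` is `O(α⁵)`,
hence smaller. -/
theorem exists_secondMoment_le : ∃ K : ℝ, 1 ≤ K ∧ ∀ α : ℝ, 0 < α → α ≤ 1 / 6 →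
    secondMoment α ≤ K * (α ^ 3 * (α * √α)) * partitionMass α := by
  refine ⟨128 + 2 * Real.pi ^ 3 * (120 * 8 ^ 5), ?_, fun α hα h6 => ?_⟩
  · have : 0 < Real.pi ^ 3 := by positivity
    nlinarith
  have hpi := Real.pi_pos
  have hsq : √α * √α = α := Real.mul_self_sqrt hα.le
  have hsqpos : 0 < √α := Real.sqrt_pos.2 hα
  have hcont := continuous_trigSum_tiltedPartitions hα
  have h1 : secondMoment α ≤ ∫ θ in (-Real.pi)..Real.pi, partitionMass α *
      (16 * α ^ 3 * Real.exp (-(1 / (16 * α ^ 3)) * θ ^ 2) +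
        Real.pi ^ 2 * Real.exp (-(1 / (8 * α)))) := by
    refine intervalIntegral.integral_mono_on (by linarith)
      (Continuous.intervalIntegrable (by fun_prop) _ _)
      (Continuous.intervalIntegrable (by fun_prop) _ _) fun θ hθ => ?_
    exact sq_mul_norm_trigSum_le hα h6 (abs_le.2 hθ)
  rw [intervalIntegral.integral_const_mul, intervalIntegral.integral_add
    (Continuous.intervalIntegrable (by fun_prop) _ _)
    (Continuous.intervalIntegrable (by fun_prop) _ _), intervalIntegral.integral_const_mul,
    intervalIntegral.integral_const, smul_eq_mul] at h1
  refine h1.trans ?_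
  rw [mul_comm]
  refine mul_le_mul_of_nonneg_right ?_ (partitionMass_nonneg α)
  have h2 : ∫ θ in (-Real.pi)..Real.pi, Real.exp (-(1 / (16 * α ^ 3)) * θ ^ 2) ≤
      8 * (α * √α) := by
    refine (intervalIntegral_gaussian_le (by positivity)).trans ?_
    rw [Real.sqrt_le_left (by positivity)]
    have e : (8 * (α * √α)) ^ 2 = 64 * α ^ 3 := by
      calc (8 * (α * √α)) ^ 2 = 64 * α ^ 2 * (√α * √α) := by ring
        _ = _ := by rw [hsq]; ring
    have e2 : Real.pi / (1 / (16 * α ^ 3)) = 16 * Real.pi * α ^ 3 := by field_simp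
    rw [e, e2]
    gcongr
    linarith [Real.pi_le_four]
  have h3 : Real.exp (-(1 / (8 * α))) ≤ 120 * 8 ^ 5 * (α ^ 3 * (α * √α)) := by
    have h4 := Real.pow_div_factorial_le_exp (x := 1 / (8 * α)) (by positivity) 5
    have h5 : Real.exp (-(1 / (8 * α))) ≤ ((1 / (8 * α)) ^ 5 / (Nat.factorial 5))⁻¹ := by
      rw [Real.exp_neg]
      exact inv_anti₀ (by positivity) h4
    refine h5.trans ?_
    have e : ((1 / (8 * α)) ^ 5 / (Nat.factorial 5) : ℝ)⁻¹ = 120 * 8 ^ 5 * (α ^ 3 * (α * α)) := by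
      have : (Nat.factorial 5 : ℝ) = 120 := by norm_num [Nat.factorial]
      rw [this]; field_simp
    rw [e]
    gcongr
    have : √α ≤ 1 := Real.sqrt_le_one.2 (by linarith)
    nlinarith
  have h6 := mul_le_mul_of_nonneg_left h2 (show 0 ≤ 16 * α ^ 3 by positivity)
  have h7 := mul_le_mul_of_nonneg_left h3
    (show 0 ≤ (Real.pi - -Real.pi) * Real.pi ^ 2 by rw [sub_neg_eq_add]; positivity)
  linarith

/-! ### Fourier coefficients and local linearity -/

theorem intervalIntegral_exp_int_mul_I (l : ℤ) :
    ∫ θ in (-Real.pi)..Real.pi, Complex.exp ((l * θ : ℝ) * Complex.I) =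
      if l = 0 then (2 * Real.pi : ℂ) else 0 := by
  split_ifs with h
  · simp [h]; ring
  · have hc : (l : ℂ) * Complex.I ≠ 0 := mul_ne_zero (by exact_mod_cast h) Complex.I_ne_zero
    have e : ∀ θ : ℝ, Complex.exp ((l * θ : ℝ) * Complex.I) =
        Complex.exp ((l : ℂ) * Complex.I * θ) := fun θ => by push_cast; ring_nf
    simp_rw [e]
    rw [integral_exp_mul_complex hc, div_eq_zero_iff, sub_eq_zero]
    left
    rw [Complex.exp_eq_exp_iff_exists_int]
    exact ⟨l, by push_cast; ring⟩

/-- The weighted partition number of `n - k`, which is `0` for `n < k`. -/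
noncomputable def shiftedPartitions (α : ℝ) (n k : ℕ) : ℝ :=
  if k ≤ n then tiltedPartitions α (n - k) else 0

theorem integral_trigSum_tiltedPartitions_mul_exp {α : ℝ} (hα : 0 < α) (n k : ℕ) :
    ∫ θ in (-Real.pi)..Real.pi, trigSum (tiltedPartitions α) θ *
      Complex.exp ((-(n * θ) : ℝ) * Complex.I) * Complex.exp ((k * θ : ℝ) * Complex.I) =
      2 * Real.pi * shiftedPartitions α n k := by
  have hs := summable_tiltedPartitions hα
  have e : ∀ (m : ℕ) (θ : ℝ), (tiltedPartitions α m : ℂ) *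
      Complex.exp ((m * θ : ℝ) * Complex.I) * (Complex.exp ((-(n * θ) : ℝ) * Complex.I) *
        Complex.exp ((k * θ : ℝ) * Complex.I)) = tiltedPartitions α m *
          Complex.exp ((((m + k - n : ℤ) : ℝ) * θ : ℝ) * Complex.I) := by
    intro m θ
    rw [mul_assoc, ← Complex.exp_add, ← Complex.exp_add]
    push_cast; ring_nf
  have h := intervalIntegral.hasSum_integral_of_dominated_convergence (μ := MeasureTheory.volume)
    (a := -Real.pi) (b := Real.pi)
    (F := fun (m : ℕ) (θ : ℝ) => (tiltedPartitions α m : ℂ) *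
      Complex.exp ((((m + k - n : ℤ) : ℝ) * θ : ℝ) * Complex.I))
    (f := fun θ => trigSum (tiltedPartitions α) θ *
      Complex.exp ((-(n * θ) : ℝ) * Complex.I) * Complex.exp ((k * θ : ℝ) * Complex.I))
    (fun m _ => tiltedPartitions α m)
    (fun m => Continuous.aestronglyMeasurable (by fun_prop))
    (fun m => Eventually.of_forall fun θ _ => by
      rw [norm_mul, Complex.norm_exp_ofReal_mul_I, mul_one, Complex.norm_real,
        Real.norm_of_nonneg (tiltedPartitions_pos α m).le])
    (Eventually.of_forall fun θ _ => hs) (by simp)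
    (Eventually.of_forall fun θ _ => by
      have := (summable_norm_trigSum hs θ).of_norm.hasSum.mul_right
        (Complex.exp ((-(n * θ) : ℝ) * Complex.I) * Complex.exp ((k * θ : ℝ) * Complex.I))
      simp only [e] at this
      rw [mul_assoc]
      exact this)
  rw [← h.tsum_eq]
  simp_rw [intervalIntegral.integral_const_mul, intervalIntegral_exp_int_mul_I]
  rw [shiftedPartitions]
  split_ifs with hk
  · rw [tsum_eq_single (n - k)]
    · rw [if_pos (by omega)]; ring
    · intro m hm
      rw [if_neg (by omega), mul_zero]
  · rw [Complex.ofReal_zero, mul_zero]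
    convert tsum_zero with m
    rw [if_neg (by omega), mul_zero]

theorem norm_exp_ofReal_mul_I_sub_one_sub_le (x : ℝ) :
    ‖Complex.exp (x * Complex.I) - 1 - x * Complex.I‖ ≤ 3 * x ^ 2 := by
  have hn : ‖(x : ℂ) * Complex.I‖ = |x| := by simp
  rcases le_total |x| 1 with h | h
  · have := Complex.norm_exp_sub_one_sub_id_le (x := x * Complex.I) (by rwa [hn])
    rw [hn, sq_abs] at this
    nlinarith [sq_nonneg x]
  · have h1 := norm_sub_le (Complex.exp (x * Complex.I) - 1) (x * Complex.I)
    have h2 := norm_sub_le (Complex.exp (x * Complex.I)) 1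
    rw [Complex.norm_exp_ofReal_mul_I, norm_one] at h2
    rw [hn] at h1
    rw [← sq_abs]
    nlinarith

/-- The numbers `p(n-k) e^{-α(n-k)}` are linear in `k` up to a quadratic error. -/
theorem exists_abs_shiftedPartitions_sub_le {α : ℝ} (hα : 0 < α) (n : ℕ) :
    ∃ B : ℝ, ∀ k : ℕ, |shiftedPartitions α n k - tiltedPartitions α n - k * B| ≤
      k ^ 2 * secondMoment α := by
  have hpi := Real.pi_pos
  have hcont := continuous_trigSum_tiltedPartitions hα
  set Ψ : ℝ → ℂ := fun θ => trigSum (tiltedPartitions α) θ *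
    Complex.exp ((-(n * θ) : ℝ) * Complex.I) with hΨ
  have hΨc : Continuous Ψ := by fun_prop
  have hΨn : ∀ θ, ‖Ψ θ‖ = ‖trigSum (tiltedPartitions α) θ‖ := fun θ => by
    rw [hΨ]; simp only [norm_mul, Complex.norm_exp_ofReal_mul_I, mul_one]
  set J : ℂ := ∫ θ in (-Real.pi)..Real.pi, Ψ θ * (θ * Complex.I) with hJ
  -- The slope is the first-order term in `e^{ikθ} = 1 + ikθ + O(k²θ²)` under the integral; the
  -- error constant `3/(2π)` is below `1`.
  refine ⟨(J / (2 * Real.pi)).re, fun k => ?_⟩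
  have h0 := integral_trigSum_tiltedPartitions_mul_exp hα n 0
  have hk := integral_trigSum_tiltedPartitions_mul_exp hα n k
  simp only [Nat.cast_zero, zero_mul, Complex.ofReal_zero, Complex.exp_zero, mul_one,
    shiftedPartitions, Nat.zero_le, if_true, Nat.sub_zero] at h0
  have h1 : ∫ θ in (-Real.pi)..Real.pi, Ψ θ *
      (Complex.exp ((k * θ : ℝ) * Complex.I) - 1 - (k * θ : ℝ) * Complex.I) =
      2 * Real.pi * shiftedPartitions α n k - 2 * Real.pi * tiltedPartitions α n - k * J := by
    rw [← h0, ← hk, hJ, ← intervalIntegral.integral_const_mul, ← intervalIntegral.integral_sub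
      (Continuous.intervalIntegrable (by fun_prop) _ _)
      (Continuous.intervalIntegrable (by fun_prop) _ _), ← intervalIntegral.integral_sub
      (Continuous.intervalIntegrable (by fun_prop) _ _)
      (Continuous.intervalIntegrable (by fun_prop) _ _)]
    refine intervalIntegral.integral_congr fun θ _ => ?_
    simp only [hΨ]
    push_cast; ring
  have h2 : ‖∫ θ in (-Real.pi)..Real.pi, Ψ θ *
      (Complex.exp ((k * θ : ℝ) * Complex.I) - 1 - (k * θ : ℝ) * Complex.I)‖ ≤
      3 * k ^ 2 * secondMoment α := by
    rw [secondMoment, ← intervalIntegral.integral_const_mul]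
    refine intervalIntegral.norm_integral_le_of_norm_le (by linarith)
      (Eventually.of_forall fun θ _ => ?_) (Continuous.intervalIntegrable (by fun_prop) _ _)
    rw [norm_mul, hΨn]
    have := mul_le_mul_of_nonneg_left (norm_exp_ofReal_mul_I_sub_one_sub_le (k * θ))
      (norm_nonneg (trigSum (tiltedPartitions α) θ))
    refine this.trans (le_of_eq ?_)
    ring
  have h3 : shiftedPartitions α n k - tiltedPartitions α n - k * (J / (2 * Real.pi)).re =
      ((∫ θ in (-Real.pi)..Real.pi, Ψ θ *
      (Complex.exp ((k * θ : ℝ) * Complex.I) - 1 - (k * θ : ℝ) * Complex.I)) /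
        (2 * Real.pi : ℝ)).re := by
    rw [h1, Complex.div_ofReal_re]
    have : (J / (2 * Real.pi)).re = J.re / (2 * Real.pi) := by
      rw [← Complex.div_ofReal_re]; push_cast; rfl
    rw [this]
    have e : (2 * Real.pi * shiftedPartitions α n k - 2 * Real.pi * tiltedPartitions α n - k * J :
        ℂ).re = 2 * Real.pi * shiftedPartitions α n k - 2 * Real.pi * tiltedPartitions α n -
          k * J.re := by
      simp
    rw [e]
    field_simp
  rw [h3]
  refine (Complex.abs_re_le_norm _).trans ?_
  rw [norm_div, Complex.norm_real, Real.norm_of_nonneg (by positivity),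
    div_le_iff₀ (by positivity)]
  refine h2.trans ?_
  have hM : 0 ≤ secondMoment α := intervalIntegral.integral_nonneg (by linarith)
    fun θ _ => by positivity
  have : 0 ≤ (k : ℝ) ^ 2 * secondMoment α := by positivity
  nlinarith [Real.pi_gt_three]

theorem two_pi_mul_tiltedPartitions {α : ℝ} (hα : 0 < α) (n : ℕ) :
    2 * Real.pi * tiltedPartitions α n = ∫ θ in (-Real.pi)..Real.pi,
      (trigSum (tiltedPartitions α) θ * Complex.exp ((-(n * θ) : ℝ) * Complex.I)).re := by
  have hcont := continuous_trigSum_tiltedPartitions hα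
  have h0 := integral_trigSum_tiltedPartitions_mul_exp hα n 0
  simp only [Nat.cast_zero, zero_mul, Complex.ofReal_zero, Complex.exp_zero, mul_one,
    shiftedPartitions, Nat.zero_le, if_true, Nat.sub_zero] at h0
  have h1 := Complex.reCLM.intervalIntegral_comp_comm (a := -Real.pi) (b := Real.pi)
    (μ := MeasureTheory.volume) (f := fun θ : ℝ => trigSum (tiltedPartitions α) θ *
      Complex.exp ((-(n * θ) : ℝ) * Complex.I))
    (Continuous.intervalIntegrable (by fun_prop) _ _)
  simp only [Complex.reCLM_apply] at h1
  rw [h1, h0]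
  simp

/-! ### Lower bound at the saddle point -/

theorem exp_neg_eight_mul_le_norm_trigSum {α θ : ℝ} (hα : 0 < α) (hθ : θ ^ 2 ≤ α ^ 3) :
    Real.exp (-8) * partitionMass α ≤ ‖trigSum (tiltedPartitions α) θ‖ := by
  rw [norm_trigSum_tiltedPartitions hα, mul_comm]
  refine mul_le_mul_of_nonneg_left (Real.exp_le_exp.2 (neg_le_neg ?_)) (partitionMass_nonneg α)
  refine (tsum_logCoeff_mul_one_sub_cos_le hα θ).trans ?_
  have h1 := sigmaSum_one_le 1 hα
  have h2 : sigmaSum 1 1 α * θ ^ 2 ≤ (1 : ℕ).factorial * (2 / α) ^ 1 * (8 / α ^ 2) * α ^ 3 := by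
    gcongr
  have e : ((1 : ℕ).factorial : ℝ) * (2 / α) ^ 1 * (8 / α ^ 2) * α ^ 3 = 16 := by
    simp; field_simp; norm_num
  linarith

/-- The choice of `n` cancels the linear phase up to `3A√α`, and the cubic remainder is at most
`(32/3)A³√α`. The phase is thus at most `1` in size, and its cosine at least `1/2`. -/
theorem half_norm_le_re_trigSum {α θ A : ℝ} {n : ℕ} (hα : 0 < α) (hA : 1 ≤ A)
    (hn : (n : ℝ) = Real.pi ^ 2 / (6 * α ^ 2)) (hs : 14 * A ^ 3 * √α ≤ 1)
    (hθ : |θ| ≤ A * (α * √α)) :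
    ‖trigSum (tiltedPartitions α) θ‖ / 2 ≤
      (trigSum (tiltedPartitions α) θ * Complex.exp ((-(n * θ) : ℝ) * Complex.I)).re := by
  rw [re_trigSum_tiltedPartitions_mul_exp hα, div_eq_mul_one_div]
  refine mul_le_mul_of_nonneg_left ?_ (norm_nonneg _)
  set ϕ := ∑' k : ℕ, logCoeff α k * Real.sin (k * θ) - n * θ with hϕ
  have hsq : √α * √α = α := Real.mul_self_sqrt hα.le
  have hspos : 0 < √α := Real.sqrt_pos.2 hα
  have h1 := abs_tsum_logCoeff_mul_sin_sub_le hα θ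
  have h2 : |sigmaSum 1 0 α * θ - n * θ| ≤ 3 / α * (A * (α * √α)) := by
    rw [← sub_mul, abs_mul]
    refine mul_le_mul ?_ hθ (abs_nonneg _) (by positivity)
    have := abs_sigmaSum_one_zero_sub_le hα
    rw [abs_le, hn]
    constructor
    · linarith
    · have : 0 < 3 / α := by positivity
      linarith
  have h3 : sigmaSum 1 2 α * |θ| ^ 3 / 6 ≤
      ((2 : ℕ).factorial * (2 / α) ^ 2 * (8 / α ^ 2)) * (A * (α * √α)) ^ 3 / 6 := by
    have := sigmaSum_one_le 2 hα
    gcongr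
  have e2 : 3 / α * (A * (α * √α)) = 3 * A * √α := by field_simp
  have e3 : ((2 : ℕ).factorial * (2 / α) ^ 2 * (8 / α ^ 2)) * (A * (α * √α)) ^ 3 / 6 =
      32 / 3 * A ^ 3 * √α := by
    have e4 : (A * (α * √α)) ^ 3 = A ^ 3 * α ^ 3 * (√α * √α) * √α := by ring
    rw [e4, hsq, Nat.factorial_two]
    push_cast
    field_simp
    norm_num
  have hA3 : A ≤ A ^ 3 := le_self_pow₀ hA (by norm_num)
  have h4 : |ϕ| ≤ 1 := by
    have h5 := abs_add_le (∑' k : ℕ, logCoeff α k * Real.sin (k * θ) - sigmaSum 1 0 α * θ)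
      (sigmaSum 1 0 α * θ - n * θ)
    rw [sub_add_sub_cancel] at h5
    have h6 : A * √α ≤ A ^ 3 * √α := by gcongr
    have h7 : 0 < A ^ 3 * √α := by positivity
    linarith
  have h5 := Real.one_sub_sq_div_two_le_cos (x := ϕ)
  have h6 : ϕ ^ 2 ≤ 1 := by rw [← sq_abs]; exact pow_le_one₀ (abs_nonneg _) h4
  linarith

/-- For `α` close to `0` and `n = π²/(6α²)`, the integral defining `secondMoment α` is
`O(α³ p(n) e^{-αn})`. -/
theorem exists_secondMoment_le_tiltedPartitions : ∃ K α₀ : ℝ, 0 < K ∧ 0 < α₀ ∧ α₀ ≤ 1 / 6 ∧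
    ∀ (α : ℝ) (n : ℕ), 0 < α → α ≤ α₀ → (n : ℝ) = Real.pi ^ 2 / (6 * α ^ 2) →
      secondMoment α ≤ K * α ^ 3 * tiltedPartitions α n := by
  obtain ⟨K, hK1, hK⟩ := exists_secondMoment_le
  have hpi := Real.pi_pos
  -- Chosen so that `M/(A²α³)` is at most half of the central contribution `e^{-8} Z β`.
  set A := √(2 * K * Real.exp 8) with hA
  have hA2 : A ^ 2 = 2 * K * Real.exp 8 := Real.sq_sqrt (by positivity)
  have hA1 : 1 ≤ A := by
    rw [hA, Real.one_le_sqrt]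
    have := Real.add_one_le_exp 8
    nlinarith
  refine ⟨4 * Real.pi * Real.exp 8 * K, min (1 / 6) ((1 / (14 * A ^ 3)) ^ 2), by positivity,
    by positivity, min_le_left _ _, fun α n hα hαle hn => ?_⟩
  have h6 : α ≤ 1 / 6 := hαle.trans (min_le_left _ _)
  have hsq : √α * √α = α := Real.mul_self_sqrt hα.le
  have hspos : 0 < √α := Real.sqrt_pos.2 hα
  have hs : 14 * A ^ 3 * √α ≤ 1 := by
    have h1 : √α ≤ 1 / (14 * A ^ 3) :=
      (Real.sqrt_le_left (by positivity)).2 (hαle.trans (min_le_right _ _))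
    rw [le_div_iff₀ (by positivity)] at h1
    linarith
  set β := α * √α with hβ
  have hβ0 : 0 < β := by positivity
  have hβ2 : β ^ 2 = α ^ 3 := by
    calc β ^ 2 = α ^ 2 * (√α * √α) := by rw [hβ]; ring
      _ = _ := by rw [hsq]; ring
  have hβpi : β ≤ Real.pi := by
    have : √α ≤ 1 := Real.sqrt_le_one.2 (by linarith)
    have : β ≤ 1 * 1 := mul_le_mul (by linarith) this hspos.le zero_le_one
    linarith [Real.pi_gt_three]
  have hcont := continuous_trigSum_tiltedPartitions hα
  set Z := partitionMass α with hZ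
  set N : ℝ → ℝ := fun θ => ‖trigSum (tiltedPartitions α) θ‖ with hN
  have hNc : Continuous N := hcont.norm
  set R : ℝ → ℝ := fun θ =>
    (trigSum (tiltedPartitions α) θ * Complex.exp ((-(n * θ) : ℝ) * Complex.I)).re with hR
  have hRc : Continuous R := by
    refine Complex.continuous_re.comp ?_
    fun_prop
  have hRN : ∀ θ, -N θ ≤ R θ := fun θ => by
    have := neg_le_of_abs_le (Complex.abs_re_le_norm
      (trigSum (tiltedPartitions α) θ * Complex.exp ((-(n * θ) : ℝ) * Complex.I)))
    rwa [norm_mul, Complex.norm_exp_ofReal_mul_I, mul_one] at this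
  -- The added term makes the integrand nonnegative: for `|θ| ≤ Aβ` already `R ≥ 0`, and beyond that
  -- it dominates `N ≥ -R`. So the integral may be cut down to `[-β, β]`.
  set g : ℝ → ℝ := fun θ => R θ + 1 / (A ^ 2 * α ^ 3) * (θ ^ 2 * N θ) with hg
  have hgc : Continuous g := by fun_prop
  have hg0 : ∀ θ, 0 ≤ g θ := by
    intro θ
    have hNθ : 0 ≤ N θ := norm_nonneg _
    rcases le_total |θ| (A * β) with h | h
    · have := half_norm_le_re_trigSum hα hA1 hn hs h
      have h2 : 0 ≤ R θ := le_trans (by positivity) this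
      exact add_nonneg h2 (by positivity)
    · have h1 : A ^ 2 * α ^ 3 ≤ θ ^ 2 := by
        rw [← hβ2, ← mul_pow, ← sq_abs θ]; gcongr
      have h2 : 1 ≤ 1 / (A ^ 2 * α ^ 3) * θ ^ 2 := by
        rw [one_div_mul_eq_div, one_le_div (by positivity)]; exact h1
      have h3 := mul_le_mul_of_nonneg_right h2 hNθ
      have h4 := hRN θ
      simp only [hg]
      linarith
  have hgβ : ∀ θ ∈ Set.Icc (-β) β, Real.exp (-8) * Z / 2 ≤ g θ := by
    intro θ hθ
    have hab := abs_le.2 hθ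
    have h1 := half_norm_le_re_trigSum hα hA1 hn hs
      (hab.trans (le_mul_of_one_le_left hβ0.le hA1))
    have h2 := exp_neg_eight_mul_le_norm_trigSum hα (θ := θ) (by
      rw [← hβ2, ← sq_abs]; gcongr)
    have h3 : 0 ≤ 1 / (A ^ 2 * α ^ 3) * (θ ^ 2 * N θ) := by
      have : 0 ≤ N θ := norm_nonneg _
      positivity
    simp only [hg, hR]
    linarith
  have hint1 : Real.exp (-8) * Z * β ≤ ∫ θ in (-Real.pi)..Real.pi, g θ := by
    have h1 : ∫ θ in (-β)..β, g θ ≤ ∫ θ in (-Real.pi)..Real.pi, g θ :=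
      intervalIntegral.integral_mono_interval (by linarith) (by linarith) hβpi
        (Eventually.of_forall hg0) (hgc.intervalIntegrable _ _)
    refine le_trans ?_ h1
    have h2 := intervalIntegral.integral_mono_on (by linarith)
      (intervalIntegrable_const (μ := MeasureTheory.volume)) (hgc.intervalIntegrable _ _) hgβ
    rw [intervalIntegral.integral_const, smul_eq_mul] at h2
    linarith
  have hint2 : ∫ θ in (-Real.pi)..Real.pi, g θ =
      2 * Real.pi * tiltedPartitions α n + 1 / (A ^ 2 * α ^ 3) * secondMoment α := by
    rw [two_pi_mul_tiltedPartitions hα, secondMoment, ← intervalIntegral.integral_const_mul,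
      ← intervalIntegral.integral_add (hRc.intervalIntegrable _ _)
      (Continuous.intervalIntegrable (by fun_prop) _ _)]
  have hM := hK α hα h6
  have hM' : 1 / (A ^ 2 * α ^ 3) * secondMoment α ≤ Real.exp (-8) * Z * β / 2 := by
    have h1 := mul_le_mul_of_nonneg_left hM (show 0 ≤ 1 / (A ^ 2 * α ^ 3) by positivity)
    refine h1.trans (le_of_eq ?_)
    rw [hA2, Real.exp_neg, ← hβ, ← hZ]
    field_simp
  have hlow : Real.exp (-8) * Z * β ≤ 4 * Real.pi * tiltedPartitions α n := by linarith
  have hZβ : Z * β ≤ 4 * Real.pi * Real.exp 8 * tiltedPartitions α n := by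
    have h1 := mul_le_mul_of_nonneg_left hlow (Real.exp_pos 8).le
    have h2 : Real.exp 8 * Real.exp (-8) = 1 := by rw [← Real.exp_add]; simp
    have h3 : Real.exp 8 * (Real.exp (-8) * Z * β) = Z * β := by
      linear_combination Z * β * h2
    linarith
  have h4 := mul_le_mul_of_nonneg_left hZβ (show 0 ≤ K * α ^ 3 by positivity)
  linarith

/-! ### From local linearity to the mean -/

open Finset in
-- The linear approximation also covers `k > n`, where the shifted value is `0`, so complete sums
-- appear with no truncation error.
theorem abs_sum_sigma_mul_tiltedPartitions_sub_le (s : ℕ) {α B M : ℝ} {n : ℕ} (hα : 0 < α)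
    (hB : ∀ k : ℕ, |shiftedPartitions α n k - tiltedPartitions α n - k * B| ≤ k ^ 2 * M) :
    |∑ x ∈ antidiagonal n, sigma s x.1 * Real.exp (-(α * x.1)) * tiltedPartitions α x.2 -
      sigmaSum s 0 α * tiltedPartitions α n - sigmaSum s 1 α * B| ≤ sigmaSum s 2 α * M := by
  have h : HasSum (fun k : ℕ => sigma s k * Real.exp (-(α * k)) * shiftedPartitions α n k)
      (∑ x ∈ antidiagonal n, sigma s x.1 * Real.exp (-(α * x.1)) * tiltedPartitions α x.2) := by
    rw [Finset.Nat.sum_antidiagonal_eq_sum_range_succ_mk]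
    have h1 : ∑ k ∈ Finset.range n.succ, sigma s k * Real.exp (-(α * k)) *
        tiltedPartitions α (n - k) = ∑ k ∈ Finset.range n.succ,
          sigma s k * Real.exp (-(α * k)) * shiftedPartitions α n k :=
      Finset.sum_congr rfl fun k hk => by
        rw [shiftedPartitions, if_pos (Nat.lt_succ_iff.1 (Finset.mem_range.1 hk))]
    rw [h1]
    refine hasSum_sum_of_ne_finset_zero fun k hk => ?_
    rw [shiftedPartitions, if_neg (by simpa using hk), mul_zero]
  have h0 := (summable_sigmaSum s 0 hα).hasSum.mul_right (tiltedPartitions α n)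
  have h1 := (summable_sigmaSum s 1 hα).hasSum.mul_right B
  have h2 := (summable_sigmaSum s 2 hα).hasSum.mul_right M
  have h3 := (h.sub h0).sub h1
  simp only [sigmaSum]
  rw [← h3.tsum_eq, ← Real.norm_eq_abs]
  refine tsum_of_norm_bounded h2 fun k => ?_
  have e : sigma s k * Real.exp (-(α * k)) * shiftedPartitions α n k -
      (k : ℝ) ^ 0 * sigma s k * Real.exp (-(α * k)) * tiltedPartitions α n -
      (k : ℝ) ^ 1 * sigma s k * Real.exp (-(α * k)) * B = sigma s k * Real.exp (-(α * k)) *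
      (shiftedPartitions α n k - tiltedPartitions α n - k * B) := by ring
  rw [e, norm_mul, Real.norm_of_nonneg (by positivity), Real.norm_eq_abs]
  have := mul_le_mul_of_nonneg_left (hB k)
    (show 0 ≤ sigma s k * Real.exp (-(α * k)) by positivity)
  linarith

theorem expectedSummands_eq (α : ℝ) (n : ℕ) :
    expectedSummands n * tiltedPartitions α n =
      ∑ x ∈ Finset.HasAntidiagonal.antidiagonal n,
        sigma 0 x.1 * Real.exp (-(α * x.1)) * tiltedPartitions α x.2 := by
  rw [← sum_antidiagonal_mul_tiltedPartitions, ← partitionMoment_one, expectedSummands,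
    partitionMoment_zero, tiltedPartitions]
  have : (numPartitions n : ℝ) ≠ 0 := by exact_mod_cast (numPartitions_pos n).ne'
  field_simp

/-- The expected number of summands is approximated by the Lambert series `∑ₖ d(k) e^{-αk}`. -/
theorem exists_abs_expectedSummands_sub_le : ∃ C α₀ : ℝ, 0 < C ∧ 0 < α₀ ∧ α₀ ≤ 1 / 6 ∧
    ∀ (α : ℝ) (n : ℕ), 0 < α → α ≤ α₀ → (n : ℝ) = Real.pi ^ 2 / (6 * α ^ 2) →
      |expectedSummands n - sigmaSum 0 0 α| ≤ C * α * sigmaSum 0 0 (α / 2) := by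
  obtain ⟨K, α₀, hK, hα₀, hα₀', hM⟩ := exists_secondMoment_le_tiltedPartitions
  refine ⟨4 * (3 + 64 * K) + 8 * K, α₀, by positivity, hα₀, hα₀', fun α n hα hle hn => ?_⟩
  obtain ⟨B, hB⟩ := exists_abs_shiftedPartitions_sub_le hα n
  have hM := hM α n hα hle hn
  have hapos := tiltedPartitions_pos α n
  set a := tiltedPartitions α n with ha
  set M := secondMoment α with hMdef
  have h1 := abs_sum_sigma_mul_tiltedPartitions_sub_le 1 hα hB
  rw [← mul_tiltedPartitions, ← ha] at h1
  have h2 := abs_sum_sigma_mul_tiltedPartitions_sub_le 0 hα hB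
  rw [← expectedSummands_eq, ← ha] at h2
  have hG0 := abs_sigmaSum_one_zero_sub_le hα
  have hG1 := le_sigmaSum_one_one hα (hle.trans hα₀')
  have hG2 : sigmaSum 1 2 α ≤ 64 / α ^ 4 := by
    refine (sigmaSum_one_le 2 hα).trans (le_of_eq ?_)
    rw [Nat.factorial_two]; push_cast; field_simp; norm_num
  -- The identity for `n p(n)` is solved for `B`: `S_{1,1} |B| = O(a/α)`, while `S_{1,1} ≥ 1/(2α³)`.
  have hBle : |B| ≤ 2 * (3 + 64 * K) * α ^ 2 * a := by
    have h3 : sigmaSum 1 1 α * |B| ≤ (3 + 64 * K) / α * a := by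
      have e : sigmaSum 1 1 α * |B| = |sigmaSum 1 1 α * B| := by
        rw [abs_mul, abs_of_nonneg (sigmaSum_nonneg _ _ _)]
      have h4 : sigmaSum 1 2 α * M ≤ 64 * K / α * a := by
        calc sigmaSum 1 2 α * M ≤ 64 / α ^ 4 * (K * α ^ 3 * a) :=
              mul_le_mul_of_nonneg hG2 hM (sigmaSum_nonneg _ _ _) (by positivity)
          _ = _ := by field_simp
      have h5 : |n * a - sigmaSum 1 0 α * a| ≤ 3 / α * a := by
        rw [← sub_mul, abs_mul, abs_of_pos hapos]
        refine mul_le_mul_of_nonneg_right ?_ hapos.le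
        rw [abs_le, hn]
        have : 0 < 3 / α := by positivity
        constructor <;> linarith
      rw [e]
      have h7 := abs_sub_abs_le_abs_sub (sigmaSum 1 1 α * B) (n * a - sigmaSum 1 0 α * a)
      rw [abs_sub_comm (sigmaSum 1 1 α * B)] at h7
      have e2 : (3 + 64 * K) / α * a = 3 / α * a + 64 * K / α * a := by ring
      linarith
    have h4 := mul_le_mul_of_nonneg_right hG1 (abs_nonneg B)
    have h5 := mul_le_mul_of_nonneg_left (h4.trans h3) (show 0 ≤ 2 * α ^ 3 by positivity)
    have e1 : 2 * α ^ 3 * (1 / (2 * α ^ 3) * |B|) = |B| := by field_simp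
    have e2 : 2 * α ^ 3 * ((3 + 64 * K) / α * a) = 2 * (3 + 64 * K) * α ^ 2 * a := by
      field_simp
    rwa [e1, e2] at h5
  set D := sigmaSum 0 0 (α / 2) with hD
  have hD0 : 0 ≤ D := sigmaSum_nonneg _ _ _
  have hD1 : sigmaSum 0 1 α ≤ 2 / α * D := by simpa using sigmaSum_le 0 1 hα
  have hD2 : sigmaSum 0 2 α ≤ 8 / α ^ 2 * D := by
    refine (sigmaSum_le 0 2 hα).trans (le_of_eq ?_)
    rw [Nat.factorial_two]; push_cast; rw [← hD]; field_simp; ring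
  have h3 : |sigmaSum 0 1 α * B| ≤ 4 * (3 + 64 * K) * α * D * a := by
    rw [abs_mul, abs_of_nonneg (sigmaSum_nonneg _ _ _)]
    calc sigmaSum 0 1 α * |B| ≤ 2 / α * D * (2 * (3 + 64 * K) * α ^ 2 * a) :=
          mul_le_mul hD1 hBle (abs_nonneg _) (by positivity)
      _ = _ := by field_simp; ring
  have h4 : sigmaSum 0 2 α * M ≤ 8 * K * α * D * a := by
    calc sigmaSum 0 2 α * M ≤ 8 / α ^ 2 * D * (K * α ^ 3 * a) :=
          mul_le_mul_of_nonneg hD2 hM (sigmaSum_nonneg _ _ _) (by positivity)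
      _ = _ := by field_simp
  have h5 : |expectedSummands n - sigmaSum 0 0 α| * a ≤
      (4 * (3 + 64 * K) + 8 * K) * α * D * a := by
    rw [← abs_of_pos hapos, ← abs_mul, abs_of_pos hapos, sub_mul]
    have := abs_sub_abs_le_abs_sub (expectedSummands n * a - sigmaSum 0 0 α * a)
      (sigmaSum 0 1 α * B)
    linarith
  exact le_of_mul_le_mul_right h5 hapos

/-- The exact formula is claimed for every `n ≥ 1`, so the main term must never vanish. Here
`log(3/4) ≥ -1/3` and `γ > 1/2` suffice. -/
theorem eulerMascheroniConstant_add_log_sqrt_pos {n : ℕ} (hn : 1 ≤ n) :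
    0 < Real.eulerMascheroniConstant + Real.log (√(6 * n) / Real.pi) := by
  have hn' : (1 : ℝ) ≤ n := by exact_mod_cast hn
  have hpi := Real.pi_pos
  have h1 : (2.4 : ℝ) ≤ √(6 * n) := by
    apply Real.le_sqrt_of_sq_le; norm_num; linarith
  have h2 : (3 / 4 : ℝ) ≤ √(6 * n) / Real.pi := by
    rw [le_div_iff₀ hpi]
    linarith [Real.pi_lt_d2]
  have h3 := Real.one_sub_inv_le_log_of_pos (show (0 : ℝ) < 3 / 4 by norm_num)
  have h4 := Real.log_le_log (by norm_num) h2
  have h5 := Real.one_half_lt_eulerMascheroniConstant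
  norm_num at h3
  linarith

theorem exists_abs_expectedSummands_sub_main_le : ∃ C α₀ : ℝ, 0 < C ∧ 0 < α₀ ∧
    ∀ (α : ℝ) (n : ℕ), 0 < α → α ≤ α₀ → (n : ℝ) = Real.pi ^ 2 / (6 * α ^ 2) →
      |expectedSummands n - (Real.eulerMascheroniConstant - Real.log α) / α| ≤
        C * (Real.eulerMascheroniConstant - Real.log α) := by
  obtain ⟨C, α₀, hC, hα₀, hα₀', h⟩ := exists_abs_expectedSummands_sub_le
  refine ⟨2 + 8 * C, α₀, by positivity, hα₀, fun α n hα hle hn => ?_⟩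
  have h1 := h α n hα hle hn
  have h2 := abs_sigmaSum_zero_zero_sub_le hα
  have h3 := (abs_le.1 (abs_sigmaSum_zero_zero_sub_le (half_pos hα))).2
  have hα1 : α ≤ 1 := by linarith
  set L := Real.eulerMascheroniConstant - Real.log α with hL
  -- This lets `L` absorb the bounded errors, including the `O(1)` of the Lambert series.
  have hL1 : 1 / 2 ≤ L := by
    have := Real.log_nonpos hα.le hα1
    have := Real.one_half_lt_eulerMascheroniConstant
    linarith
  have h4 : α * sigmaSum 0 0 (α / 2) ≤ 8 * L := by
    rw [Real.log_div hα.ne' two_ne_zero] at h3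
    have h5 : sigmaSum 0 0 (α / 2) ≤ (L + Real.log 2) / (α / 2) + 1 := by
      have : Real.eulerMascheroniConstant - (Real.log α - Real.log 2) = L + Real.log 2 := by
        rw [hL]; ring
      rw [this] at h3
      linarith
    have h6 := mul_le_mul_of_nonneg_left h5 hα.le
    have e : α * ((L + Real.log 2) / (α / 2) + 1) = 2 * (L + Real.log 2) + α := by field_simp
    have := Real.log_two_lt_d9
    linarith
  have h5 := mul_le_mul_of_nonneg_left h4 hC.le
  have h6 := abs_sub_le (expectedSummands n) (sigmaSum 0 0 α) (L / α)
  linarith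

end

theorem mainTheorem9 :
    ∃ ε : ℕ → ℝ,
      (ε =O[atTop] fun n : ℕ => (n : ℝ) ^ (-(1 / 2) : ℝ)) ∧
      ∀ n : ℕ, 1 ≤ n →
        expectedSummands n =
          Real.sqrt (6 * n) / Real.pi *
            (Real.eulerMascheroniConstant + Real.log (Real.sqrt (6 * n) / Real.pi)) *
            (1 + ε n) := by
  have hpi := Real.pi_pos
  have hmain : ∀ n : ℕ, 1 ≤ n → 0 < √(6 * n) / Real.pi *
      (Real.eulerMascheroniConstant + Real.log (√(6 * n) / Real.pi)) := by
    intro n hn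
    have hn' : (0 : ℝ) < n := by exact_mod_cast hn
    exact mul_pos (by positivity) (eulerMascheroniConstant_add_log_sqrt_pos hn)
  -- `ε` is forced to be the relative error; with `α = π/√(6n)` the main term is `L/α`, and an
  -- absolute error `C L` becomes `C α`.
  refine ⟨fun n => expectedSummands n / (√(6 * n) / Real.pi *
    (Real.eulerMascheroniConstant + Real.log (√(6 * n) / Real.pi))) - 1, ?_, fun n hn => ?_⟩
  · obtain ⟨C, α₀, hC, hα₀, h⟩ := exists_abs_expectedSummands_sub_main_le
    refine IsBigO.of_bound (C * Real.pi) ?_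
    filter_upwards [eventually_ge_atTop (max 1 ⌈(Real.pi / α₀) ^ 2⌉₊)] with n hn
    have hn1 : 1 ≤ n := (le_max_left _ _).trans hn
    have hn0 : (0 : ℝ) < n := by exact_mod_cast hn1
    have hn2 : (Real.pi / α₀) ^ 2 ≤ n :=
      (Nat.le_ceil _).trans (by exact_mod_cast (le_max_right _ _).trans hn)
    have hs : 0 < √(6 * (n : ℝ)) := by positivity
    set α := Real.pi / √(6 * (n : ℝ)) with hα
    have hα0 : 0 < α := by positivity
    have hαle : α ≤ α₀ := by
      rw [hα, div_le_iff₀ hs, ← div_le_iff₀' hα₀]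
      exact Real.le_sqrt_of_sq_le (by linarith)
    have hnα : (n : ℝ) = Real.pi ^ 2 / (6 * α ^ 2) := by
      rw [hα, div_pow, Real.sq_sqrt (by positivity)]
      field_simp
    have hinv : √(6 * (n : ℝ)) / Real.pi = α⁻¹ := by rw [hα, inv_div]
    have hm := hmain n hn1
    rw [hinv, Real.log_inv, ← sub_eq_add_neg] at hm ⊢
    have h1 := h α n hα0 hαle hnα
    set L := Real.eulerMascheroniConstant - Real.log α with hL
    have hL0 : 0 < L := pos_of_mul_pos_right hm (by positivity)
    have e : expectedSummands n / (α⁻¹ * L) - 1 = (expectedSummands n - L / α) * (α / L) := by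
      field_simp
    rw [e, norm_mul, Real.norm_eq_abs, Real.norm_of_nonneg (by positivity : 0 ≤ α / L)]
    have h2 : |expectedSummands n - L / α| * (α / L) ≤ C * L * (α / L) := by gcongr
    have h3 : C * L * (α / L) = C * α := by field_simp
    have h4 : α ≤ Real.pi * (n : ℝ) ^ (-(1 / 2) : ℝ) := by
      rw [Real.rpow_neg hn0.le, ← Real.sqrt_eq_rpow, hα, div_eq_mul_inv]
      gcongr
      linarith
    rw [Real.norm_of_nonneg (by positivity)]
    calc _ ≤ C * α := h2.trans h3.le
      _ ≤ C * (Real.pi * (n : ℝ) ^ (-(1 / 2) : ℝ)) := by gcongr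
      _ = _ := by ring
  · have := (hmain n hn).ne'
    rw [add_sub_cancel, mul_div_cancel₀ _ this]
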